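/- Let $d\ge 1$ and fix a smooth function $\chi:\mathbb R^d\to[0,1]$, supported in the open ball $B(0,4/3)$ and equal to $1$ on the closed ball $\bar B(0,3/4)$. Put $\varphi(\xi)=\chi(\xi/2)-\chi(\xi)$ and, for $j\in\mathbb Z$ and a tempered distribution $f$ on $\mathbb R^d$, $\dot\Delta_jf=\varphi(2^{-j}D)f$ and $\dot S_jf=\chi(2^{-j}D)f$, where $D=-i\nabla$; these are smooth functions. Let $\mathcal S'_h$ be the set of tempered distributions $f$ with $\lim_{j\to-\infty}\|\dot S_jf\|_{L^\infty}=0$. For $\sigma\in\mathbb R$, $q\in[1,\infty)$ and a threshold $J_1\in\mathbb Z$, define, with values in $[0,\infty]$, $$\|f\|_{\dot{\mathbb B}^{\sigma}_{q,1}}=\sum_{j\in\mathbb Z}2^{j\sigma}\|\dot\Delta_jf\|_{L^q},\qquad \|f\|^{\ell}_{\dot{\mathbb B}^{\sigma}_{q,1}}=\sum_{j\le J_1+1}2^{j\sigma}\|\dot\Delta_jf\|_{L^q},\qquad \|f\|^{h}_{\dot{\mathbb B}^{\sigma}_{q,1}}=\sum_{j\ge J_1}2^{j\sigma}\|\dot\Delta_jf\|_{L^q},$$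 and let $\|\nabla f\|$, in any of these norms, be the sum of the norms of $\partial_1f,\dots,\partial_df$. The product $wz$ of $w,z\in\mathcal S'_h$ is the limit of $\dot S_Nw\,\dot S_Nz$ in the space of tempered distributions as $N\to\infty$, whenever this limit exists. Let $p\in[2,4]$, $s>0$, $J_1\in\mathbb Z$, $\sigma_1\ge s$ and $\sigma_2\in\mathbb R$, and let $p^*=2p/(p-2)$ (with $p^*=\infty$ and $d/p^*=0$ if $p=2$). There is a constant $C$, depending only on $J_1,s,p,d,\sigma_1,\sigma_2$ (and on the fixed function $\chi$), such that for all $k\ge0$ and all $w,z\in\mathcal S'_h$ whose product $wz$ exists, the functions $\mathfrak R_j=\dot S_{j-1}w\,\dot\Delta_jz-\dot\Delta_j(wz)$ satisfy $$\sum_{j\ge J_1}2^{js}\|\mathfrak R_j\|_{L^2}\le C\Bigl(\|\nabla w\|_{\dot{\mathbb B}^{d/p}_{p,1}}\|z\|^h_{\dot{\mathbb B}^{s-1}_{2,1}}+\|z\|^\ell_{\dot{\mathbb B}^{d/p-d/p^*}_{p,1}}\|w\|^\ell_{\dot{\mathbb B}^{\sigma_1}_{p,1}}+\|z\|_{\dot{\mathbb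 B}^{d/p-k}_{p,1}}\|w\|^h_{\dot{\mathbb B}^{s+k}_{2,1}}+\|z\|^\ell_{\dot{\mathbb B}^{\sigma_2}_{p,1}}\|\nabla w\|^\ell_{\dot{\mathbb B}^{d/p-d/p^*}_{p,1}}\Bigr),$$ both sides being taken in $[0,\infty]$ with $0\cdot\infty=0$. -/

import Mathlib

open MeasureTheory Filter Topology FourierTransform LineDeriv
open scoped SchwartzMap ContDiff ENNReal NNReal

/-- `ℝ^d` with its Euclidean norm. -/
abbrev Rd (d : ℕ) : Type := EuclideanSpace ℝ (Fin d)

/-- A smooth function `χ : ℝ^d → [0,1]` supported in the open ball `B(0,4/3)` and equal to `1` on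
the closed ball of radius `3/4`. -/
structure LPCutoff (d : ℕ) where
  toFun : Rd d → ℝ
  smooth : ContDiff ℝ ∞ toFun
  mem_Icc : ∀ ξ, toFun ξ ∈ Set.Icc (0 : ℝ) 1
  tsupport_subset : tsupport toFun ⊆ Metric.ball 0 (4 / 3)
  eq_one : ∀ ξ ∈ Metric.closedBall (0 : Rd d) (3 / 4), toFun ξ = 1

/-- A smooth compactly supported Fourier multiplier symbol. -/
structure CompactSymbol (d : ℕ) where
  toFun : Rd d → ℝ
  smooth : ContDiff ℝ ∞ toFun
  compact : HasCompactSupport toFun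

noncomputable section

namespace CompactSymbol

variable {d : ℕ}

/-- The rescaled symbol `ξ ↦ m (a ξ)`, for `a ≠ 0`. -/
def dilate (m : CompactSymbol d) (a : ℝ) (ha : a ≠ 0) : CompactSymbol d where
  toFun ξ := m.toFun (a • ξ)
  smooth := m.smooth.comp (contDiff_const_smul a)
  compact := m.compact.comp_homeomorph (Homeomorph.smulOfNeZero a ha)

/-- The difference of two symbols. -/
def sub (m₁ m₂ : CompactSymbol d) : CompactSymbol d where
  toFun ξ := m₁.toFun ξ - m₂.toFun ξ
  smooth := m₁.smooth.sub m₂.smooth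
  compact := m₁.compact.sub m₂.compact

/-- The test function `ξ ↦ m(ξ) e^{2πi x·ξ}`. -/
def waveTest (m : CompactSymbol d) (x : Rd d) : 𝓢(Rd d, ℂ) :=
  HasCompactSupport.toSchwartzMap
    (f := fun ξ => (m.toFun ξ : ℂ) * Complex.exp (2 * Real.pi * Complex.I * (inner ℝ x ξ : ℝ)))
    ((m.compact.comp_left (g := fun r : ℝ => (r : ℂ)) Complex.ofReal_zero).mul_right)
    ((Complex.ofRealCLM.contDiff.comp m.smooth).mul
      (Complex.contDiff_exp.comp
        (contDiff_const.mul (Complex.ofRealCLM.contDiff.comp (contDiff_const.inner ℝ contDiff_id)))))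

/-- The smooth function `𝓕⁻¹(m 𝓕f)`, for a tempered distribution `f` and Mathlib's Fourier transform
`𝓕f(ξ) = ∫ e^{-2πi x·ξ} f(x) dx`. Since `m` is compactly supported, its value at `x` is
`⟨𝓕f, m e^{2πi x·(·)}⟩`. -/
def apply (m : CompactSymbol d) (f : 𝓢'(Rd d, ℂ)) (x : Rd d) : ℂ :=
  (𝓕 f) (m.waveTest x)

/-- The smooth function `m(aD)f` with `D = -i∇`. In Mathlib's normalization of the
Fourier transform, `D` has symbol `2πξ`. -/
def applyD (m : CompactSymbol d) (a : ℝ) (ha : a ≠ 0) (f : 𝓢'(Rd d, ℂ)) : Rd d → ℂ :=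
  (m.dilate (a * (2 * Real.pi)) (mul_ne_zero ha Real.two_pi_pos.ne')).apply f

end CompactSymbol

namespace LPCutoff

variable {d : ℕ}

/-- The symbol `χ`. -/
def chi (χ : LPCutoff d) : CompactSymbol d where
  toFun := χ.toFun
  smooth := χ.smooth
  compact := HasCompactSupport.of_support_subset_isCompact (isCompact_closedBall 0 (4 / 3))
    ((subset_tsupport _).trans (χ.tsupport_subset.trans Metric.ball_subset_closedBall))

/-- The symbol `φ(ξ) = χ(ξ/2) - χ(ξ)`. -/
def phi (χ : LPCutoff d) : CompactSymbol d :=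
  (χ.chi.dilate 2⁻¹ (by norm_num)).sub χ.chi

/-- The low-frequency cut-off `Ṡ_j f = χ(2^{-j}D) f`. -/
def lowCut (χ : LPCutoff d) (j : ℤ) (f : 𝓢'(Rd d, ℂ)) : Rd d → ℂ :=
  χ.chi.applyD ((2 : ℝ) ^ (-j)) (zpow_ne_zero _ two_ne_zero) f

/-- The homogeneous dyadic block `Δ̇_j f = φ(2^{-j}D) f`. -/
def block (χ : LPCutoff d) (j : ℤ) (f : 𝓢'(Rd d, ℂ)) : Rd d → ℂ :=
  χ.phi.applyD ((2 : ℝ) ^ (-j)) (zpow_ne_zero _ two_ne_zero) f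

/-- `f ∈ 𝓢'_h`: the `L^∞` norm of `Ṡ_j f` tends to `0` as `j → -∞`. -/
def MemSh (χ : LPCutoff d) (f : 𝓢'(Rd d, ℂ)) : Prop :=
  Tendsto (fun j : ℤ => eLpNorm (χ.lowCut j f) ∞ volume) atBot (𝓝 0)

/-- The weighted norm `2^{jσ} ‖Δ̇_j f‖_{L^p}`. -/
def blockNorm (χ : LPCutoff d) (σ p : ℝ) (f : 𝓢'(Rd d, ℂ)) (j : ℤ) : ℝ≥0∞ :=
  (2 : ℝ≥0∞) ^ ((j : ℝ) * σ) * eLpNorm (χ.block j f) (ENNReal.ofReal p) volume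

/-- The homogeneous Besov norm `‖f‖_{Ḃ^σ_{p,1}}`, with value in `[0,∞]`. -/
def besov (χ : LPCutoff d) (σ p : ℝ) (f : 𝓢'(Rd d, ℂ)) : ℝ≥0∞ :=
  ∑' j : ℤ, χ.blockNorm σ p f j

/-- The low-frequency norm `‖f‖^{ℓ,J}_{Ḃ^σ_{p,1}}`: the sum over `j ≤ J + 1`. -/
def besovLow (χ : LPCutoff d) (J : ℤ) (σ p : ℝ) (f : 𝓢'(Rd d, ℂ)) : ℝ≥0∞ :=
  ∑' j : Set.Iic (J + 1), χ.blockNorm σ p f j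

/-- The high-frequency norm `‖f‖^{h,J}_{Ḃ^σ_{p,1}}`: the sum over `j ≥ J`. -/
def besovHigh (χ : LPCutoff d) (J : ℤ) (σ p : ℝ) (f : 𝓢'(Rd d, ℂ)) : ℝ≥0∞ :=
  ∑' j : Set.Ici J, χ.blockNorm σ p f j

/-- The partial derivative `∂_i f` in the sense of distributions. -/
def partialD (i : Fin d) (f : 𝓢'(Rd d, ℂ)) : 𝓢'(Rd d, ℂ) :=
  ∂_{(EuclideanSpace.single i (1 : ℝ) : Rd d)} f

/-- `‖∇f‖_{Ḃ^σ_{p,1}}`, the sum of the norms of the components. -/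
def besovGrad (χ : LPCutoff d) (σ p : ℝ) (f : 𝓢'(Rd d, ℂ)) : ℝ≥0∞ :=
  ∑ i : Fin d, χ.besov σ p (partialD i f)

/-- `‖∇f‖^{ℓ,J}_{Ḃ^σ_{p,1}}`, the sum of the norms of the components. -/
def besovGradLow (χ : LPCutoff d) (J : ℤ) (σ p : ℝ) (f : 𝓢'(Rd d, ℂ)) : ℝ≥0∞ :=
  ∑ i : Fin d, χ.besovLow J σ p (partialD i f)

/-- The tempered distribution `u` is the product `wz`: the products of smooth functions
`Ṡ_N w Ṡ_N z = ∑_{i,j < N} Δ̇_i w Δ̇_j z` converge to `u` in `𝓢'` as `N → ∞`. -/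
def IsProduct (χ : LPCutoff d) (w z u : 𝓢'(Rd d, ℂ)) : Prop :=
  ∀ g : 𝓢(Rd d, ℂ),
    Tendsto (fun N : ℤ => ∫ x, χ.lowCut N w x * χ.lowCut N z x * g x) atTop (𝓝 (u g))

/-- The remainder `Ṡ_{j-1}w Δ̇_j z - Δ̇_j(wz)`, where `u` is the product `wz`. -/
def remainder (χ : LPCutoff d) (w z u : 𝓢'(Rd d, ℂ)) (j : ℤ) (x : Rd d) : ℂ :=
  χ.lowCut (j - 1) w x * χ.block j z x - χ.block j u x

end LPCutoff

/-- The number `d/p*`, where `p* = 2p/(p-2)` (and `p* = ∞`, `d/p* = 0` for `p = 2`). -/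
def dOverPStar (d : ℕ) (p : ℝ) : ℝ := d * ((p - 2) / (2 * p))

end

/-! Decompose w and z into dyadic blocks. Since `Ṡ_{j-1}` is the sum of the blocks of index at most
j - 2, the pair (i, l) contributes to the remainder the commutator of `Δ̇_j` with multiplication by
`Δ̇_i w`, applied to `Δ̇_l z`, when i ≤ j - 2, and only -`Δ̇_j`(`Δ̇_i w` `Δ̇_l z`) when i ≥ j - 1.
Membership in `𝓢'_h`, the definition of the product and Fatou's lemma bound the L² norm of the
remainder by the sum of the norms of these contributions (`eLpNorm_remainder_le`); no convergence of
the double series has to be known beforehand.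

Frequencies add under multiplication, so a pair can contribute only if i ≤ j - 2 and |l - j| ≤ 4, or
i ≥ j - 1 and l ≤ i + 3 (`remainderTerm_eq_zero`). The commutator gains 2^{-j} and puts a gradient
on w (`eLpNorm_commutator_le`); the other terms follow from Young and Hölder. Bernstein's inequality
converts L^p into L^∞ or L^{p*}, and its converse trades a block of w for 2^{-i} times a block of
its gradient.

For j ≥ J the surviving pairs fall into four classes, one for each product on the right
(`exists_remainderTerm_le`). If l ≥ J and either i ≤ j - 2 or l > i, the gradient of w is measured
in L^∞ and z in L². If i ≥ J and l ≤ i, w is measured in L² and z in L^∞, and k derivatives pass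
from z to w because 2^{lk} ≤ 2^{ik}. If i ≤ j - 2 and l < J, then j is within 3 of J and Hölder with
(p*, p) applies to the commutator. What is left is j = J, i = J - 1, l < J, estimated by Hölder with
(p, p*).

Each bound carries a factor 2^{-s|j-m|} with m one of l, i, J. Summing over j first costs a fixed
geometric series, since s > 0, and the remaining sum over (i, l) factors into a product of two
norms.

The analytic device underneath is that a tempered distribution may be moved inside an integral of
translates of a Schwartz function (`SchwartzMap.apply_eq_integral`). It yields the composition of
multipliers, the mean value formula and the spectral localization of products. -/

open scoped BoundedContinuousFunction

noncomputable section

/-! ### Tempered distributions as bounded functionals on a Banach space of jets -/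

section Jet

variable {E : Type*} [NormedAddCommGroup E] [NormedSpace ℝ E]

theorem SchwartzMap.exists_one_add_norm_pow_mul_le (K : 𝓢(E, ℂ)) (k n : ℕ) :
    ∃ B : ℝ, 0 ≤ B ∧ ∀ y, (1 + ‖y‖) ^ k * ‖iteratedFDeriv ℝ n K y‖ ≤ B :=
  ⟨_, by positivity, fun y => one_add_le_sup_seminorm_apply (𝕜 := ℂ) (m := (k, n)) le_rfl le_rfl K y⟩

/-- The space of bounded continuous functions in which the derivatives of order `n` live. -/
abbrev DerivSpace (E : Type*) [NormedAddCommGroup E] [NormedSpace ℝ E] (n : ℕ) : Type _ :=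
  E →ᵇ (E [×n]→L[ℝ] ℂ)

instance DerivSpace.instNormedAddCommGroup (n : ℕ) : NormedAddCommGroup (DerivSpace E n) :=
  BoundedContinuousFunction.instNormedAddCommGroup

instance DerivSpace.instNormedSpace (n : ℕ) : NormedSpace ℂ (DerivSpace E n) :=
  BoundedContinuousFunction.instNormedSpace

/-- The product of the spaces of derivatives of order at most `N`. -/
abbrev JetSpace (E : Type*) [NormedAddCommGroup E] [NormedSpace ℝ E] (N : ℕ) : Type _ :=
  Π n : Fin (N + 1), DerivSpace E n

instance JetSpace.instNormedAddCommGroup (N : ℕ) : NormedAddCommGroup (JetSpace E N) :=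
  Pi.normedAddCommGroup

instance JetSpace.instNormedSpace (N : ℕ) : NormedSpace ℂ (JetSpace E N) :=
  Pi.normedSpace

/-- The derivative of order `n` of a Schwartz function, multiplied by the weight `(1 + ‖y‖)^k`, as
a bounded continuous function. -/
def SchwartzMap.weightedDeriv (k n : ℕ) : 𝓢(E, ℂ) →ₗ[ℂ] DerivSpace E n where
  toFun K := BoundedContinuousFunction.ofNormedAddCommGroup
    (fun y => (1 + ‖y‖) ^ k • iteratedFDeriv ℝ n K y)
    ((by fun_prop : Continuous fun y : E => (1 + ‖y‖) ^ k).smul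
      ((K.smooth n).continuous_iteratedFDeriv le_rfl))
    (K.exists_one_add_norm_pow_mul_le k n).choose
    (fun y => by
      rw [norm_smul, Real.norm_of_nonneg (by positivity)]
      exact (K.exists_one_add_norm_pow_mul_le k n).choose_spec.2 y)
  map_add' K L := by
    ext1 y
    have : iteratedFDeriv ℝ n (⇑(K + L)) y = iteratedFDeriv ℝ n K y + iteratedFDeriv ℝ n L y :=
      iteratedFDeriv_add_apply (K.smooth n).contDiffAt (L.smooth n).contDiffAt
    change (1 + ‖y‖) ^ k • iteratedFDeriv ℝ n (⇑(K + L)) y = _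
    rw [this, smul_add]
    rfl
  map_smul' c K := by
    ext1 y
    have : iteratedFDeriv ℝ n (⇑(c • K)) y = c • iteratedFDeriv ℝ n K y :=
      iteratedFDeriv_const_smul_apply (K.smooth n).contDiffAt
    change (1 + ‖y‖) ^ k • iteratedFDeriv ℝ n (⇑(c • K)) y = _
    rw [this, smul_comm]
    rfl

@[simp]
theorem SchwartzMap.weightedDeriv_apply (k n : ℕ) (K : 𝓢(E, ℂ)) (y : E) :
    SchwartzMap.weightedDeriv k n K y = (1 + ‖y‖) ^ k • iteratedFDeriv ℝ n K y := rfl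

/-- The family of the weighted derivatives of order at most `N` of a Schwartz function. -/
def SchwartzMap.jet (k N : ℕ) : 𝓢(E, ℂ) →ₗ[ℂ] (JetSpace E N) :=
  LinearMap.pi fun n => SchwartzMap.weightedDeriv k n

theorem SchwartzMap.jet_apply (k N : ℕ) (K : 𝓢(E, ℂ)) (n : Fin (N + 1)) :
    SchwartzMap.jet k N K n = SchwartzMap.weightedDeriv k n K := rfl

theorem SchwartzMap.seminorm_le_norm_jet {k N k' n' : ℕ} (hk : k' ≤ k) (hn : n' ≤ N)
    (K : 𝓢(E, ℂ)) : SchwartzMap.seminorm ℂ k' n' K ≤ ‖SchwartzMap.jet k N K‖ := by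
  refine SchwartzMap.seminorm_le_bound ℂ k' n' K (norm_nonneg _) fun y => ?_
  calc ‖y‖ ^ k' * ‖iteratedFDeriv ℝ n' K y‖ ≤ (1 + ‖y‖) ^ k * ‖iteratedFDeriv ℝ n' K y‖ := by
        gcongr
        calc ‖y‖ ^ k' ≤ (1 + ‖y‖) ^ k' := by gcongr; simp
          _ ≤ (1 + ‖y‖) ^ k := pow_le_pow_right₀ (by simp) hk
    _ = ‖SchwartzMap.weightedDeriv k n' K y‖ := by
        rw [SchwartzMap.weightedDeriv_apply, norm_smul, Real.norm_of_nonneg (by positivity)]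
    _ ≤ ‖SchwartzMap.weightedDeriv k n' K‖ := BoundedContinuousFunction.norm_coe_le_norm _ _
    _ ≤ _ := norm_le_pi_norm (SchwartzMap.jet k N K) ⟨n', by omega⟩

/-- Continuity bounds T by a finite supremum of Schwartz seminorms; the largest weight and the
largest order among them give one jet norm dominating them all. -/
theorem SchwartzMap.exists_norm_le_jet (T : 𝓢(E, ℂ) →L[ℂ] ℂ) :
    ∃ (k N : ℕ) (C : ℝ), 0 ≤ C ∧ ∀ K, ‖T K‖ ≤ C * ‖SchwartzMap.jet k N K‖ := by
  have hcont : Continuous ((normSeminorm ℂ ℂ).comp T.toLinearMap) :=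
    continuous_norm.comp T.continuous
  obtain ⟨s, C, -, hC⟩ := Seminorm.bound_of_continuous (schwartz_withSeminorms ℂ E ℂ) _ hcont
  refine ⟨s.sup Prod.fst, s.sup Prod.snd, C, C.2, fun K => ?_⟩
  refine (hC K).trans ?_
  rw [smul_apply, NNReal.smul_def, smul_eq_mul]
  gcongr
  refine Seminorm.finset_sup_apply_le (norm_nonneg _) fun m hm => ?_
  exact SchwartzMap.seminorm_le_norm_jet (Finset.le_sup (f := Prod.fst) hm)
    (Finset.le_sup (f := Prod.snd) hm) K

theorem SchwartzMap.jet_injective (k N : ℕ) : Function.Injective (SchwartzMap.jet (E := E) k N) := by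
  intro K L h
  ext y
  have h0 := congrArg (fun f => f y) (congrFun h 0)
  have h1 : (1 + ‖y‖) ^ k • K y = (1 + ‖y‖) ^ k • L y :=
    congrArg (fun f => f 0) h0
  exact smul_right_injective ℂ (by positivity : (1 + ‖y‖) ^ k ≠ 0) h1

/-- A tempered distribution is a continuous functional of a jet. -/
theorem SchwartzMap.exists_extension_jet (T : 𝓢(E, ℂ) →L[ℂ] ℂ) :
    ∃ (k N : ℕ) (Λ : StrongDual ℂ (JetSpace E N)),
      ∀ K, T K = Λ (SchwartzMap.jet k N K) := by
  obtain ⟨k, N, C, hC, h⟩ := SchwartzMap.exists_norm_le_jet T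
  -- T factors through the range of the jet map, where it is bounded for the sup norm; Hahn–Banach
  -- extends it to the whole jet space.
  let e := LinearEquiv.ofInjective (SchwartzMap.jet (E := E) k N) (SchwartzMap.jet_injective k N)
  let f : StrongDual ℂ (LinearMap.range (SchwartzMap.jet (E := E) k N)) :=
    (T.toLinearMap ∘ₗ e.symm.toLinearMap).mkContinuous C fun v => by
      have := h (e.symm v)
      have h2 : SchwartzMap.jet k N (e.symm v) = v := congrArg Subtype.val (e.apply_symm_apply v)
      rw [h2] at this
      exact this
  obtain ⟨Λ, hΛ, -⟩ := exists_extension_norm_eq _ f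
  refine ⟨k, N, Λ, fun K => ?_⟩
  have := hΛ (e K)
  have h3 : f (e K) = T K := by
    change T (e.symm (e K)) = T K
    rw [e.symm_apply_apply]
  rw [← h3, ← this]
  rfl

theorem one_add_norm_pow_le_mul {E : Type*} [SeminormedAddCommGroup E] (k : ℕ) (y x : E) :
    (1 + ‖y‖) ^ k ≤ (1 + ‖x‖) ^ k * (1 + ‖y - x‖) ^ k := by
  rw [← mul_pow]
  gcongr
  have : ‖y‖ ≤ ‖y - x‖ + ‖x‖ := by simpa using norm_add_le (y - x) x
  nlinarith [norm_nonneg x, norm_nonneg (y - x), mul_nonneg (norm_nonneg x) (norm_nonneg (y - x))]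

theorem SchwartzMap.iteratedFDeriv_compSubConstCLM (K : 𝓢(E, ℂ)) (n : ℕ) (x y : E) :
    iteratedFDeriv ℝ n (K.compSubConstCLM ℂ x) y = iteratedFDeriv ℝ n K (y - x) :=
  iteratedFDeriv_comp_sub n x y

theorem SchwartzMap.exists_norm_jet_compSubConstCLM_le (K : 𝓢(E, ℂ)) (k N : ℕ) :
    ∃ B : ℝ, 0 ≤ B ∧ ∀ x, ‖SchwartzMap.jet k N (K.compSubConstCLM ℂ x)‖ ≤ B * (1 + ‖x‖) ^ k := by
  choose B hB0 hB using K.exists_one_add_norm_pow_mul_le k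
  refine ⟨∑ n : Fin (N + 1), B n, Finset.sum_nonneg fun n _ => hB0 n, fun x => ?_⟩
  have hnn : 0 ≤ (∑ n : Fin (N + 1), B n) * (1 + ‖x‖) ^ k :=
    mul_nonneg (Finset.sum_nonneg fun n _ => hB0 n) (by positivity)
  refine (pi_norm_le_iff_of_nonneg hnn).2 fun n => ?_
  refine (BoundedContinuousFunction.norm_le hnn).2 fun y => ?_
  rw [SchwartzMap.jet_apply, SchwartzMap.weightedDeriv_apply,
    SchwartzMap.iteratedFDeriv_compSubConstCLM, norm_smul, Real.norm_of_nonneg (by positivity)]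
  calc (1 + ‖y‖) ^ k * ‖iteratedFDeriv ℝ n K (y - x)‖
      ≤ ((1 + ‖x‖) ^ k * (1 + ‖y - x‖) ^ k) * ‖iteratedFDeriv ℝ n K (y - x)‖ := by
        gcongr; exact one_add_norm_pow_le_mul k y x
    _ = ((1 + ‖y - x‖) ^ k * ‖iteratedFDeriv ℝ n K (y - x)‖) * (1 + ‖x‖) ^ k := by ring
    _ ≤ B n * (1 + ‖x‖) ^ k := by gcongr; exact hB n _
    _ ≤ _ := by
        gcongr
        exact Finset.single_le_sum (f := fun n : Fin (N + 1) => B n) (fun n _ => hB0 n)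
          (Finset.mem_univ n)

/-- Each weighted derivative is locally Lipschitz in the translation parameter, uniformly in y: this
is the mean value inequality together with the decay of the derivative of the next order. Continuity
gives the measurability needed to integrate jets of translates. -/
theorem SchwartzMap.continuous_jet_compSubConstCLM (K : 𝓢(E, ℂ)) (k N : ℕ) :
    Continuous fun x : E => SchwartzMap.jet k N (K.compSubConstCLM ℂ x) := by
  refine continuous_pi fun n => continuous_iff_continuousAt.2 fun x => ?_
  obtain ⟨B, hB0, hB⟩ := K.exists_one_add_norm_pow_mul_le k (n + 1)
  have key : ∀ x' : E, ‖x' - x‖ ≤ 1 →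
      ‖SchwartzMap.jet k N (K.compSubConstCLM ℂ x') n - SchwartzMap.jet k N (K.compSubConstCLM ℂ x) n‖
        ≤ ((2 + ‖x‖) ^ k * B) * ‖x' - x‖ := by
    intro x' hx'
    refine (BoundedContinuousFunction.norm_le (by positivity)).2 fun y => ?_
    rw [BoundedContinuousFunction.coe_sub, Pi.sub_apply, SchwartzMap.jet_apply,
      SchwartzMap.jet_apply, SchwartzMap.weightedDeriv_apply, SchwartzMap.weightedDeriv_apply,
      SchwartzMap.iteratedFDeriv_compSubConstCLM, SchwartzMap.iteratedFDeriv_compSubConstCLM]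
    have hpos : 0 < (1 + ‖y‖) ^ k := by positivity
    have hmv : ‖iteratedFDeriv ℝ n K (y - x') - iteratedFDeriv ℝ n K (y - x)‖ ≤
        ((2 + ‖x‖) ^ k * B / (1 + ‖y‖) ^ k) * ‖(y - x') - (y - x)‖ := by
      refine (convex_segment (y - x) (y - x')).norm_image_sub_le_of_norm_fderiv_le (𝕜 := ℝ)
        (f := iteratedFDeriv ℝ n K) (fun v _ => ?_) (fun v hv => ?_)
        (left_mem_segment ℝ _ _) (right_mem_segment ℝ _ _)
      · exact ((K.smooth (n + 1)).differentiable_iteratedFDeriv (by exact_mod_cast Nat.lt_succ_self _)) v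
      · rw [norm_fderiv_iteratedFDeriv, le_div_iff₀ hpos]
        -- A point v of the segment is within 1 of y - x, so replacing the weight at y by the weight
        -- at v costs at most (2 + ‖x‖)^k.
        have hv1 : ‖y - v‖ ≤ ‖x‖ + 1 := by
          have : v ∈ Metric.closedBall (y - x) 1 :=
            (convex_closedBall (y - x) 1).segment_subset (Metric.mem_closedBall_self zero_le_one)
              (by simpa [dist_eq_norm, norm_sub_rev] using hx') hv
          rw [Metric.mem_closedBall, dist_eq_norm] at this
          calc ‖y - v‖ = ‖x - (v - (y - x))‖ := by congr 1; abel
            _ ≤ ‖x‖ + ‖v - (y - x)‖ := norm_sub_le _ _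
            _ ≤ _ := by gcongr
        calc ‖iteratedFDeriv ℝ (n + 1) K v‖ * (1 + ‖y‖) ^ k
            ≤ ‖iteratedFDeriv ℝ (n + 1) K v‖ * ((1 + ‖y - v‖) ^ k * (1 + ‖v‖) ^ k) := by
              gcongr
              simpa using one_add_norm_pow_le_mul k y (y - v)
          _ = (1 + ‖y - v‖) ^ k * ((1 + ‖v‖) ^ k * ‖iteratedFDeriv ℝ (n + 1) K v‖) := by ring
          _ ≤ (2 + ‖x‖) ^ k * B := by
              gcongr ?_ ^ k * ?_
              · linarith
              · exact hB v
    calc _ = ‖(1 + ‖y‖) ^ k • (iteratedFDeriv ℝ n K (y - x') - iteratedFDeriv ℝ n K (y - x))‖ :=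
          congrArg norm (smul_sub _ _ _).symm
      _ = (1 + ‖y‖) ^ k * ‖iteratedFDeriv ℝ n K (y - x') - iteratedFDeriv ℝ n K (y - x)‖ := by
          rw [norm_smul, Real.norm_of_nonneg (by positivity)]
      _ ≤ (1 + ‖y‖) ^ k * (((2 + ‖x‖) ^ k * B / (1 + ‖y‖) ^ k) * ‖(y - x') - (y - x)‖) := by gcongr
      _ = ((2 + ‖x‖) ^ k * B) * ‖x' - x‖ := by
        rw [show (y - x') - (y - x) = x - x' by abel, norm_sub_rev]
        field_simp
  rw [ContinuousAt, tendsto_iff_norm_sub_tendsto_zero]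
  refine squeeze_zero' (g := fun x' => ((2 + ‖x‖) ^ k * B) * ‖x' - x‖)
    (Eventually.of_forall fun _ => norm_nonneg _) ?_ ?_
  · filter_upwards [Metric.closedBall_mem_nhds x one_pos] with x' hx'
    exact key x' (by simpa [dist_eq_norm] using hx')
  · have : Tendsto (fun x' : E => ((2 + ‖x‖) ^ k * B) * ‖x' - x‖) (𝓝 x)
        (𝓝 (((2 + ‖x‖) ^ k * B) * ‖x - x‖)) := by
      apply Continuous.tendsto; fun_prop
    simpa using this

end Jet

/-! ### Exchanging a tempered distribution with an integral -/

section Exchange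

variable {E : Type*} [NormedAddCommGroup E] [NormedSpace ℝ E]
 
theorem SchwartzMap.exists_norm_iteratedFDeriv_le (K : 𝓢(E, ℂ)) (n : ℕ) :
    ∃ B : ℝ, 0 ≤ B ∧ ∀ y, ‖iteratedFDeriv ℝ n K y‖ ≤ B := by
  obtain ⟨B, hB, h⟩ := K.exists_one_add_norm_pow_mul_le 0 n
  exact ⟨B, hB, by simpa using h⟩

theorem SchwartzMap.exists_norm_apply_compSubConstCLM_le (T : 𝓢(E, ℂ) →L[ℂ] ℂ) (K : 𝓢(E, ℂ)) :
    ∃ (k : ℕ) (B : ℝ), 0 ≤ B ∧ ∀ x, ‖T (K.compSubConstCLM ℂ x)‖ ≤ B * (1 + ‖x‖) ^ k := by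
  obtain ⟨k, N, C, hC, h⟩ := SchwartzMap.exists_norm_le_jet T
  obtain ⟨B, hB, h'⟩ := K.exists_norm_jet_compSubConstCLM_le k N
  refine ⟨k, C * B, by positivity, fun x => (h _).trans ?_⟩
  rw [mul_assoc]
  gcongr
  exact h' x

theorem SchwartzMap.continuous_apply_compSubConstCLM (T : 𝓢(E, ℂ) →L[ℂ] ℂ) (K : 𝓢(E, ℂ)) :
    Continuous fun x => T (K.compSubConstCLM ℂ x) := by
  obtain ⟨k, N, Λ, hΛ⟩ := SchwartzMap.exists_extension_jet T
  simp only [hΛ]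
  exact Λ.continuous.comp (K.continuous_jet_compSubConstCLM k N)

variable [MeasurableSpace E] [BorelSpace E] [SecondCountableTopology E]
variable {X : Type*} [MeasurableSpace X] {μ : Measure X}

theorem integrable_smul_comp_sub {E F X : Type*} [NormedAddCommGroup E] [MeasurableSpace E]
    [BorelSpace E] [SecondCountableTopology E] [MeasurableSpace X] {μ : Measure X}
    [NormedAddCommGroup F] [NormedSpace ℂ F]
    {c : X → E} (hc : Measurable c) {g : X → ℂ} (hg : Integrable g μ) {f : E → F}
    (hf : Continuous f) {B : ℝ} (hB : ∀ v, ‖f v‖ ≤ B) (y : E) :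
    Integrable (fun t => g t • f (y - c t)) μ := by
  refine (hg.norm.mul_const B).mono' (hg.aestronglyMeasurable.smul ?_)
    (Eventually.of_forall fun t => ?_)
  · have hcont : Continuous fun v => f (y - v) := hf.comp (continuous_const.sub continuous_id)
    exact (hcont.stronglyMeasurable.comp_measurable hc).aestronglyMeasurable
  · rw [norm_smul]
    gcongr
    exact hB _

theorem fderiv_integral_smul_comp_sub {F : Type*} [NormedAddCommGroup F] [NormedSpace ℝ F]
    [NormedSpace ℂ F] [SMulCommClass ℝ ℂ F] {c : X → E} (hc : Measurable c) {g : X → ℂ}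
    (hg : Integrable g μ) {f : E → F} (hf : ContDiff ℝ 1 f) {B₀ B₁ : ℝ}
    (hB₀ : ∀ v, ‖f v‖ ≤ B₀) (hB₁ : ∀ v, ‖fderiv ℝ f v‖ ≤ B₁) (y v : E) :
    Integrable (fun t => g t • fderiv ℝ f (y - c t) v) μ ∧
    fderiv ℝ (fun y => ∫ t, g t • f (y - c t) ∂μ) y v =
      ∫ t, g t • fderiv ℝ f (y - c t) v ∂μ := by
  have hint : Integrable (fun t => g t • fderiv ℝ f (y - c t)) μ :=
    integrable_smul_comp_sub hc hg (hf.continuous_fderiv one_ne_zero) hB₁ y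
  have key : HasFDerivAt (fun y => ∫ t, g t • f (y - c t) ∂μ)
      (∫ t, g t • fderiv ℝ f (y - c t) ∂μ) y := by
    refine hasFDerivAt_integral_of_dominated_of_fderiv_le (𝕜 := ℝ)
      (F' := fun y t => g t • fderiv ℝ f (y - c t)) (bound := fun t => ‖g t‖ * B₁)
      (s := Set.univ) univ_mem
      (Eventually.of_forall fun v =>
        (integrable_smul_comp_sub hc hg hf.continuous hB₀ v).aestronglyMeasurable)
      (integrable_smul_comp_sub hc hg hf.continuous hB₀ y) hint.aestronglyMeasurable ?_
      (hg.norm.mul_const B₁) ?_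
    · refine Eventually.of_forall fun t v _ => ?_
      rw [norm_smul]
      gcongr
      exact hB₁ _
    · refine Eventually.of_forall fun t v _ => ?_
      have h1 : HasFDerivAt (fun v => f (v - c t)) (fderiv ℝ f (v - c t)) v :=
        ((hf.differentiable one_ne_zero _).hasFDerivAt).comp v ((hasFDerivAt_id v).sub_const (c t))
      exact h1.const_smul (g t)
  refine ⟨hint.apply_continuousLinearMap v, ?_⟩
  rw [key.fderiv, ContinuousLinearMap.integral_apply hint]
  rfl

theorem SchwartzMap.integrable_smul_iteratedFDeriv_sub (K : 𝓢(E, ℂ)) (n : ℕ) {c : X → E}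
    (hc : Measurable c) {g : X → ℂ} (hg : Integrable g μ) (y : E) :
    Integrable (fun t => g t • iteratedFDeriv ℝ n K (y - c t)) μ := by
  obtain ⟨B, hB, h⟩ := K.exists_norm_iteratedFDeriv_le n
  exact integrable_smul_comp_sub hc hg ((K.smooth n).continuous_iteratedFDeriv le_rfl) h y

/-- Differentiation under the integral sign, one order at a time; a bounded derivative of K times
the integrable g dominates. -/
theorem SchwartzMap.iteratedFDeriv_eq_integral {K h : 𝓢(E, ℂ)} {c : X → E} (hc : Measurable c)
    {g : X → ℂ} (hg : Integrable g μ) (hh : ∀ y, h y = ∫ t, g t * K (y - c t) ∂μ) (n : ℕ) (y : E) :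
    iteratedFDeriv ℝ n h y = ∫ t, g t • iteratedFDeriv ℝ n K (y - c t) ∂μ := by
  induction n generalizing y with
  | zero =>
    ext m
    rw [ContinuousMultilinearMap.integral_apply
      (K.integrable_smul_iteratedFDeriv_sub 0 hc hg y)]
    simpa using hh y
  | succ n ih =>
    obtain ⟨B, -, hb⟩ := K.exists_norm_iteratedFDeriv_le (n + 1)
    obtain ⟨B₀, -, hb₀⟩ := K.exists_norm_iteratedFDeriv_le n
    have hC : ContDiff ℝ 1 (iteratedFDeriv ℝ n K) :=
      (K.smooth (n + 1)).iteratedFDeriv_right (m := 1) (i := n) (by norm_cast; omega)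
    ext m
    rw [ContinuousMultilinearMap.integral_apply
      (K.integrable_smul_iteratedFDeriv_sub (n + 1) hc hg y), iteratedFDeriv_succ_apply_left,
      funext ih]
    obtain ⟨h1, h2⟩ := fderiv_integral_smul_comp_sub hc hg hC hb₀ (B₁ := B)
      (fun v => by rw [norm_fderiv_iteratedFDeriv]; exact hb v) y (m 0)
    rw [h2, ContinuousMultilinearMap.integral_apply h1]
    simp [iteratedFDeriv_succ_apply_left]

/-- A tempered distribution commutes with integrals of translates of a Schwartz function. -/
theorem SchwartzMap.apply_eq_integral (T : 𝓢(E, ℂ) →L[ℂ] ℂ) {K h : 𝓢(E, ℂ)} {c : X → E}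
    (hc : Measurable c) {g : X → ℂ} (hg : AEStronglyMeasurable g μ)
    (hgk : ∀ k : ℕ, Integrable (fun t => (1 + ‖c t‖) ^ k * ‖g t‖) μ)
    (hh : ∀ y, h y = ∫ t, g t * K (y - c t) ∂μ) :
    T h = ∫ t, g t * T (K.compSubConstCLM ℂ (c t)) ∂μ := by
  have hgi : Integrable g μ := (integrable_norm_iff hg).1 (by simpa using hgk 0)
  obtain ⟨k, N, Λ, hΛ⟩ := SchwartzMap.exists_extension_jet T
  have hint : Integrable (fun t => g t • SchwartzMap.jet k N (K.compSubConstCLM ℂ (c t))) μ := by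
    have : SecondCountableTopologyEither E (JetSpace E N) :=
      secondCountableTopologyEither_of_left E _
    obtain ⟨B, hB, hb⟩ := K.exists_norm_jet_compSubConstCLM_le k N
    refine ((hgk k).const_mul B).mono' (hg.smul
      ((K.continuous_jet_compSubConstCLM k N).stronglyMeasurable.comp_measurable
        hc).aestronglyMeasurable) (Eventually.of_forall fun t => ?_)
    rw [norm_smul]
    calc ‖g t‖ * _ ≤ ‖g t‖ * (B * (1 + ‖c t‖) ^ k) := by gcongr; exact hb _
      _ = _ := by ring
  -- The jet of h is the Bochner integral of the jets of the translates. It suffices to test each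
  -- component at each point, where this is the formula for the derivatives of h; the bounded
  -- functional Λ then passes inside.
  have hjet : SchwartzMap.jet k N h =
      ∫ t, g t • SchwartzMap.jet k N (K.compSubConstCLM ℂ (c t)) ∂μ := by
    funext n
    ext1 y
    let ev : JetSpace E N →L[ℝ] (E [×n]→L[ℝ] ℂ) :=
      (BoundedContinuousFunction.evalCLM ℝ y).comp (ContinuousLinearMap.proj n)
    have h1 := ev.integral_comp_comm hint
    change _ = ev _
    rw [← h1, SchwartzMap.jet_apply, SchwartzMap.weightedDeriv_apply,
      SchwartzMap.iteratedFDeriv_eq_integral hc hgi hh, ← integral_smul]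
    refine integral_congr_ae (Eventually.of_forall fun t => ?_)
    change _ = g t • ((1 + ‖y‖) ^ k • iteratedFDeriv ℝ n (K.compSubConstCLM ℂ (c t)) y)
    rw [SchwartzMap.iteratedFDeriv_compSubConstCLM]
    exact smul_comm _ _ _
  rw [hΛ, hjet, ← Λ.integral_comp_comm hint]
  simp [hΛ]

end Exchange

/-! ### Multipliers with Schwartz symbol, their kernels and the spectrum of products -/

section Multiplier

variable {d : ℕ}

/-- The smooth function `𝓕⁻¹(a 𝓕T)`, for a Schwartz symbol `a` and a tempered distribution `T`. -/
def schwartzMultiplier (a : 𝓢(Rd d, ℂ)) (T : 𝓢'(Rd d, ℂ)) (x : Rd d) : ℂ :=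
  T ((𝓕 a).compSubConstCLM ℂ x)

/-- The correlation `x ↦ ∫ K(y - x) f(y) dy`. -/
def correlation (K : 𝓢(Rd d, ℂ)) (f : Rd d → ℂ) (x : Rd d) : ℂ := ∫ y, K (y - x) * f y

theorem exists_norm_schwartzMultiplier_le (a : 𝓢(Rd d, ℂ)) (T : 𝓢'(Rd d, ℂ)) :
    ∃ (k : ℕ) (B : ℝ), 0 ≤ B ∧ ∀ x, ‖schwartzMultiplier a T x‖ ≤ B * (1 + ‖x‖) ^ k :=
  SchwartzMap.exists_norm_apply_compSubConstCLM_le T (𝓕 a)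

theorem continuous_schwartzMultiplier (a : 𝓢(Rd d, ℂ)) (T : 𝓢'(Rd d, ℂ)) :
    Continuous (schwartzMultiplier a T) :=
  SchwartzMap.continuous_apply_compSubConstCLM T (𝓕 a)

theorem schwartzMultiplier_add (a b : 𝓢(Rd d, ℂ)) (T : 𝓢'(Rd d, ℂ)) (x : Rd d) :
    schwartzMultiplier (a + b) T x = schwartzMultiplier a T x + schwartzMultiplier b T x := by
  simp only [schwartzMultiplier, FourierTransform.fourier_add, map_add]

theorem schwartzMultiplier_smul (c : ℂ) (a : 𝓢(Rd d, ℂ)) (T : 𝓢'(Rd d, ℂ)) (x : Rd d) :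
    schwartzMultiplier (c • a) T x = c * schwartzMultiplier a T x := by
  simp only [schwartzMultiplier, FourierTransform.fourier_smul, map_smul, smul_eq_mul]

theorem schwartzMultiplier_sub (a b : 𝓢(Rd d, ℂ)) (T : 𝓢'(Rd d, ℂ)) (x : Rd d) :
    schwartzMultiplier (a - b) T x = schwartzMultiplier a T x - schwartzMultiplier b T x := by
  rw [sub_eq_add_neg, schwartzMultiplier_add, ← neg_one_smul ℂ, schwartzMultiplier_smul]
  ring

theorem schwartzMultiplier_sum {ι : Type*} (s : Finset ι) (a : ι → 𝓢(Rd d, ℂ)) (T : 𝓢'(Rd d, ℂ))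
    (x : Rd d) :
    schwartzMultiplier (∑ i ∈ s, a i) T x = ∑ i ∈ s, schwartzMultiplier (a i) T x := by
  classical
  induction s using Finset.induction_on with
  | empty => simpa using schwartzMultiplier_smul 0 (0 : 𝓢(Rd d, ℂ)) T x
  | insert i s hi ih => rw [Finset.sum_insert hi, Finset.sum_insert hi, schwartzMultiplier_add, ih]

theorem TemperedDistribution.apply_eq_integral {X : Type*} [MeasurableSpace X] {μ : Measure X}
    (T : 𝓢'(Rd d, ℂ)) {K h : 𝓢(Rd d, ℂ)} {c : X → Rd d}
    (hc : Measurable c) {g : X → ℂ} (hg : AEStronglyMeasurable g μ)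
    (hgk : ∀ k : ℕ, Integrable (fun t => (1 + ‖c t‖) ^ k * ‖g t‖) μ)
    (hh : ∀ y, h y = ∫ t, g t * K (y - c t) ∂μ) :
    T h = ∫ t, g t * T (K.compSubConstCLM ℂ (c t)) ∂μ :=
  SchwartzMap.apply_eq_integral T hc hg hgk hh

theorem SchwartzMap.integrable_one_add_norm_pow_mul (K : 𝓢(Rd d, ℂ)) (k : ℕ) (x : Rd d) :
    Integrable (fun y => (1 + ‖y‖) ^ k * ‖K (y - x)‖) := by
  have h1 : Integrable fun y => (1 + ‖x‖) ^ k * (2 ^ k * (‖K y‖ + ‖y‖ ^ k * ‖K y‖)) :=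
    (((K.integrable.norm).add (K.integrable_pow_mul volume k)).const_mul _).const_mul _
  refine (h1.comp_sub_right x).mono' (by fun_prop) (Eventually.of_forall fun y => ?_)
  rw [Real.norm_of_nonneg (by positivity)]
  have h2 : (1 + ‖y - x‖) ^ k ≤ 2 ^ k * (1 + ‖y - x‖ ^ k) := by
    have := add_pow_le (zero_le_one (α := ℝ)) (norm_nonneg (y - x)) k
    refine this.trans ?_
    rw [one_pow]
    gcongr
    · norm_num
    · omega
  calc (1 + ‖y‖) ^ k * ‖K (y - x)‖
      ≤ ((1 + ‖x‖) ^ k * (1 + ‖y - x‖) ^ k) * ‖K (y - x)‖ := by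
        gcongr; exact one_add_norm_pow_le_mul k y x
    _ ≤ ((1 + ‖x‖) ^ k * (2 ^ k * (1 + ‖y - x‖ ^ k))) * ‖K (y - x)‖ := by gcongr
    _ = _ := by ring

theorem SchwartzMap.fourierInv_apply_neg (a : 𝓢(Rd d, ℂ)) (ξ : Rd d) :
    (𝓕⁻ a : 𝓢(Rd d, ℂ)) ξ = 𝓕 a (-ξ) := by
  rw [SchwartzMap.fourierInv_coe, SchwartzMap.fourier_coe, Real.fourierInv_eq_fourier_neg]

theorem SchwartzMap.fourier_fourier_apply (a : 𝓢(Rd d, ℂ)) (ξ : Rd d) :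
    𝓕 (𝓕 a) ξ = a (-ξ) := by
  have h := SchwartzMap.fourierInv_apply_neg (𝓕 a) (-ξ)
  rw [FourierTransform.fourierInv_fourier_eq, neg_neg] at h
  exact h.symm

/-- The Fourier transform of a product is the convolution of the Fourier transforms. -/
theorem SchwartzMap.integral_fourier_mul_fourier_sub (a b c : 𝓢(Rd d, ℂ))
    (hc : ∀ ξ, c ξ = b ξ * a ξ) (t : Rd d) : ∫ y, (𝓕 b) y * (𝓕 a) (t - y) = (𝓕 c) t := by
  have h1 : SchwartzMap.convolution (ContinuousLinearMap.mul ℂ ℂ) (𝓕 b) (𝓕 a) = 𝓕 c := by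
    apply (FourierTransform.fourierEquiv ℂ 𝓢(Rd d, ℂ)).injective
    ext ξ
    change 𝓕 (SchwartzMap.convolution (ContinuousLinearMap.mul ℂ ℂ) (𝓕 b) (𝓕 a)) ξ = 𝓕 (𝓕 c) ξ
    rw [SchwartzMap.fourier_convolution, SchwartzMap.pairing_apply_apply]
    simp only [SchwartzMap.fourier_fourier_apply, hc, ContinuousLinearMap.mul_apply']
  rw [← h1, SchwartzMap.convolution_apply]
  rfl

theorem SchwartzMap.fourier_compSubConstCLM_apply (K : 𝓢(Rd d, ℂ)) (t ξ : Rd d) :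
    𝓕 (K.compSubConstCLM ℂ t) ξ = Real.fourierChar (-inner ℝ t ξ) • 𝓕 K ξ := by
  have h := congrFun (VectorFourier.fourierIntegral_comp_add_right Real.fourierChar volume
    (innerₗ (Rd d)) (K : Rd d → ℂ) (-t)) ξ
  simp only [map_neg, LinearMap.neg_apply, innerₗ_apply_apply] at h
  simpa only [SchwartzMap.fourier_coe, sub_eq_add_neg] using! h

theorem integral_fourier_sub_mul_fourier_sub (a b c : 𝓢(Rd d, ℂ)) (hc : ∀ ξ, c ξ = b ξ * a ξ)
    (x t : Rd d) : ∫ y, (𝓕 b) (y - x) * (𝓕 a) (t - y) = (𝓕 c) (t - x) := by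
  have h := integral_sub_right_eq_self (μ := volume)
    (fun y : Rd d => ((𝓕 b) y * (𝓕 a) (t - x - y) : ℂ)) x
  rw [← SchwartzMap.integral_fourier_mul_fourier_sub a b c hc (t - x), ← h]
  simp

/-- Composition of two multipliers, the second one acting by its kernel. -/
theorem correlation_schwartzMultiplier (a b c : 𝓢(Rd d, ℂ)) (hc : ∀ ξ, c ξ = b ξ * a ξ)
    (T : 𝓢'(Rd d, ℂ)) (x : Rd d) :
    correlation (𝓕 b) (schwartzMultiplier a T) x = schwartzMultiplier c T x := by
  refine (TemperedDistribution.apply_eq_integral (K := 𝓕 a) (c := fun y => y) T measurable_id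
    (g := fun y => (𝓕 b) (y - x)) (by fun_prop)
    (fun k => SchwartzMap.integrable_one_add_norm_pow_mul _ k x) fun t => ?_).symm
  rw [integral_fourier_sub_mul_fourier_sub a b c hc x t, SchwartzMap.compSubConstCLM_apply]

theorem SchwartzMap.lineDerivOp_compSubConstCLM (K : 𝓢(Rd d, ℂ)) (v x : Rd d) :
    ∂_{v} (K.compSubConstCLM ℂ x) = (∂_{v} K).compSubConstCLM ℂ x := by
  ext y
  rw [SchwartzMap.lineDerivOp_apply_eq_fderiv, SchwartzMap.compSubConstCLM_apply,
    SchwartzMap.lineDerivOp_apply_eq_fderiv]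
  congr 1
  exact fderiv_comp_sub x 

/-- The sign from duality cancels the sign in the derivative of a Fourier transform, so a derivative
on T multiplies the symbol by 2πi ξ·v. -/
theorem schwartzMultiplier_lineDerivOp (a b : 𝓢(Rd d, ℂ)) (v : Rd d)
    (hb : ∀ ξ, b ξ = 2 * Real.pi * Complex.I * (inner ℝ ξ v : ℝ) * a ξ)
    (T : 𝓢'(Rd d, ℂ)) (x : Rd d) :
    schwartzMultiplier a (∂_{v} T) x = schwartzMultiplier b T x := by
  simp only [schwartzMultiplier, TemperedDistribution.lineDerivOp_apply_apply]
  congr 1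
  rw [SchwartzMap.lineDerivOp_compSubConstCLM, ← map_neg, SchwartzMap.lineDerivOp_fourier_eq,
    ← FourierTransform.fourier_neg]
  congr 2
  ext ξ
  have : (inner ℝ · v : Rd d → ℝ).HasTemperateGrowth := ((innerSL ℝ).flip v).hasTemperateGrowth
  simp [this, hb, mul_assoc]

theorem lineDerivOp_eq_sum (T : 𝓢'(Rd d, ℂ)) (v : Rd d) :
    ∂_{v} T = ∑ i, v i • LPCutoff.partialD i T := by
  have hv : v = ∑ i, v i • (EuclideanSpace.single i (1 : ℝ) : Rd d) := by
    simpa using ((EuclideanSpace.basisFun (Fin d) ℝ).sum_repr v).symm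
  conv_lhs => rw [hv]
  rw [lineDerivOp_left_sum]
  simp only [lineDerivOp_left_smul, LPCutoff.partialD]

/-- A mean value formula for a multiplier: write the difference of two translates of the kernel as
an integral along the segment, bring T inside, and move the derivative from the kernel onto T. -/
theorem schwartzMultiplier_sub_eq_integral (a : 𝓢(Rd d, ℂ)) (T : 𝓢'(Rd d, ℂ)) (x y : Rd d) :
    schwartzMultiplier a T x - schwartzMultiplier a T y =
      ∫ t in Set.Icc (0 : ℝ) 1, ∑ i, ((x - y) i : ℂ) *
        schwartzMultiplier a (LPCutoff.partialD i T) (y + t • (x - y)) := by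
  set K := 𝓕 a with hK
  set c : ℝ → Rd d := fun t => y + t • (x - y) with hc
  have hcont : Continuous c := by fun_prop
  have hderiv : ∀ v t, HasDerivAt (fun t => K (v - c t)) ((-∂_{x - y} K) (v - c t)) t := by
    intro v t
    have h1 : HasDerivAt (fun t => v - c t) (-(x - y)) t := by
      simpa using (((hasDerivAt_id t).smul_const (x - y)).const_add y).const_sub v
    have h2 := (K.hasFDerivAt (v - c t)).comp_hasDerivAt t h1
    rw [map_neg] at h2
    exact h2
  have key := TemperedDistribution.apply_eq_integral (K := -∂_{x - y} K)
    (h := K.compSubConstCLM ℂ x - K.compSubConstCLM ℂ y) (μ := volume.restrict (Set.Icc (0 : ℝ) 1))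
    T hcont.measurable (g := fun _ => 1) (by fun_prop)
    (fun k => by
      have : Continuous fun t => (1 + ‖c t‖) ^ k * ‖(1 : ℂ)‖ := by fun_prop
      exact this.continuousOn.integrableOn_compact isCompact_Icc)
    (fun v => by
      rw [integral_Icc_eq_integral_Ioc, ← intervalIntegral.integral_of_le zero_le_one]
      simp only [one_mul]
      rw [intervalIntegral.integral_eq_sub_of_hasDerivAt (fun t _ => hderiv v t)]
      · simp [hc]
      · refine Continuous.intervalIntegrable ?_ _ _
        fun_prop)
  rw [show schwartzMultiplier a T x - schwartzMultiplier a T y =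
    T (K.compSubConstCLM ℂ x - K.compSubConstCLM ℂ y) from (map_sub T _ _).symm]
  refine key.trans (integral_congr_ae (Eventually.of_forall fun t => ?_))
  have h3 : T ((-∂_{x - y} K).compSubConstCLM ℂ (c t)) =
      (∂_{x - y} T) (K.compSubConstCLM ℂ (c t)) := by
    rw [TemperedDistribution.lineDerivOp_apply_apply, SchwartzMap.lineDerivOp_compSubConstCLM,
      map_neg]
  simp only [one_mul]
  rw [h3, lineDerivOp_eq_sum]
  simp [schwartzMultiplier, hK, hc]

/-- By Parseval the integral is, up to phases, the double integral of a(ξ) b(η) c(ξ - η), whose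
integrand vanishes identically. -/
theorem integral_fourier_mul_fourier_mul_fourier_eq_zero (a b c : 𝓢(Rd d, ℂ))
    (habc : ∀ ξ η, a ξ = 0 ∨ b η = 0 ∨ c (ξ - η) = 0) (x t r : Rd d) :
    ∫ y, (𝓕 a) (y - x) * (𝓕 b) (t - y) * (𝓕 c) (r - y) = 0 := by
  let refl : 𝓢(Rd d, ℂ) →L[ℂ] 𝓢(Rd d, ℂ) :=
    SchwartzMap.compCLMOfContinuousLinearEquiv ℂ (LinearIsometryEquiv.neg ℝ).toContinuousLinearEquiv
  have hrefl : ∀ (f : 𝓢(Rd d, ℂ)) y, refl f y = f (-y) := fun f y => rfl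
  have hFrefl : ∀ f : 𝓢(Rd d, ℂ), refl (𝓕 f) = 𝓕⁻ f := fun f => by
    ext y
    rw [hrefl, SchwartzMap.fourierInv_apply_neg]
  have hF : ∀ (f : 𝓢(Rd d, ℂ)) (t ξ : Rd d), f ξ = 0 →
      𝓕 ((refl (𝓕 f)).compSubConstCLM ℂ t) ξ = 0 := fun f t ξ h => by
    rw [SchwartzMap.fourier_compSubConstCLM_apply, hFrefl, FourierTransform.fourier_fourierInv_eq,
      h, smul_zero]
  have hFi : ∀ (f : 𝓢(Rd d, ℂ)) (t ξ : Rd d), f ξ = 0 →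
      (𝓕⁻ ((𝓕 f).compSubConstCLM ℂ t) : 𝓢(Rd d, ℂ)) ξ = 0 := fun f t ξ h => by
    rw [SchwartzMap.fourierInv_apply_neg, SchwartzMap.fourier_compSubConstCLM_apply, SchwartzMap.fourier_fourier_apply, neg_neg, h,
      smul_zero]
  set A := (𝓕 a).compSubConstCLM ℂ x
  set B := (refl (𝓕 b)).compSubConstCLM ℂ t
  set C := (refl (𝓕 c)).compSubConstCLM ℂ r
  set BC := SchwartzMap.pairing (ContinuousLinearMap.mul ℂ ℂ) B C
  have h1 : ∫ y, (𝓕 (𝓕⁻ A)) y * BC y = ∫ ξ, (𝓕⁻ A) ξ * (𝓕 BC) ξ :=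
    SchwartzMap.integral_fourier_mul_eq _ _
  rw [FourierTransform.fourier_fourierInv_eq] at h1
  have h2 : ∀ ξ, (𝓕⁻ A) ξ * (𝓕 BC) ξ = 0 := by
    intro ξ
    rw [← SchwartzMap.integral_fourier_mul_fourier_sub C B BC (fun ξ => rfl) ξ, ← integral_const_mul]
    rw [← integral_zero (Rd d) ℂ]
    refine integral_congr_ae (Eventually.of_forall fun η => ?_)
    rcases habc ξ η with h | h | h
    · simp [A, hFi a x ξ h]
    · simp [B, hF b t η h]
    · simp [C, hF c r _ h]
  simp only [h2, integral_zero] at h1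
  rw [← h1]
  refine integral_congr_ae (Eventually.of_forall fun y => ?_)
  simp [A, B, C, BC, hrefl, mul_assoc]

/-- Frequencies of a product are sums of frequencies of the factors. The identity for three kernels
holds for all t and r; applying S in the variable r and then T in the variable t replaces two
kernels by the distributions. Polynomial growth of multipliers against Schwartz decay justifies both
exchanges. -/
theorem correlation_mul_eq_zero (a b c : 𝓢(Rd d, ℂ))
    (habc : ∀ ξ η, a ξ = 0 ∨ b η = 0 ∨ c (ξ - η) = 0) (T S : 𝓢'(Rd d, ℂ)) (x : Rd d) :
    correlation (𝓕 a) (fun y => schwartzMultiplier b T y * schwartzMultiplier c S y) x = 0 := by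
  have hzero : ∀ t, ∫ y, (𝓕 a) (y - x) * schwartzMultiplier c S y * (𝓕 b) (t - y) = 0 := by
    intro t
    have h := TemperedDistribution.apply_eq_integral (K := 𝓕 c) (h := 0) (c := fun y => y) (μ := volume) S
      measurable_id (g := fun y => (𝓕 a) (y - x) * (𝓕 b) (t - y)) (by fun_prop)
      (fun k => ?_) fun r => ?_
    · rw [map_zero] at h
      rw [h]
      refine integral_congr_ae (Eventually.of_forall fun y => ?_)
      simp only [schwartzMultiplier]
      ring
    · obtain ⟨B, hB0, hB⟩ := (𝓕 b).exists_norm_iteratedFDeriv_le 0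
      refine ((SchwartzMap.integrable_one_add_norm_pow_mul (𝓕 a) k x).mul_const B).mono'
        (by fun_prop) (Eventually.of_forall fun y => ?_)
      rw [Real.norm_of_nonneg (by positivity), norm_mul, mul_assoc]
      gcongr
      simpa using hB (t - y)
    · exact (integral_fourier_mul_fourier_mul_fourier_eq_zero a b c habc x t r).symm
  have h := TemperedDistribution.apply_eq_integral (K := 𝓕 b) (h := 0) (c := fun y => y) (μ := volume) T
    measurable_id (g := fun y => (𝓕 a) (y - x) * schwartzMultiplier c S y)
    (((𝓕 a).continuous.comp (continuous_sub_right x)).mul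
      (continuous_schwartzMultiplier c S)).aestronglyMeasurable
    (fun k => ?_) fun t => (hzero t).symm
  · rw [map_zero] at h
    rw [h, correlation]
    refine integral_congr_ae (Eventually.of_forall fun y => ?_)
    simp only [schwartzMultiplier]
    ring
  · obtain ⟨n, B, hB0, hB⟩ := exists_norm_schwartzMultiplier_le c S
    refine ((SchwartzMap.integrable_one_add_norm_pow_mul (𝓕 a) (k + n) x).mul_const B).mono'
      ?_ (Eventually.of_forall fun y => ?_)
    · have := continuous_schwartzMultiplier c S
      have : Continuous fun y => (1 + ‖y‖) ^ k * ‖(𝓕 a) (y - x) * schwartzMultiplier c S y‖ := by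
        fun_prop
      exact this.aestronglyMeasurable
    rw [Real.norm_of_nonneg (by positivity), norm_mul]
    calc (1 + ‖y‖) ^ k * (‖(𝓕 a) (y - x)‖ * ‖schwartzMultiplier c S y‖)
        ≤ (1 + ‖y‖) ^ k * (‖(𝓕 a) (y - x)‖ * (B * (1 + ‖y‖) ^ n)) := by gcongr; exact hB y
      _ = _ := by ring

end Multiplier

/-! ### Convolution, interpolation and commutator estimates in Lebesgue spaces -/

section LpEstimates

/-- Minkowski's integral inequality in `L²`, for a weighted superposition of functions. -/
theorem eLpNorm_two_le_of_enorm_le_lintegral {X Y : Type*} [MeasurableSpace X] [MeasurableSpace Y]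
    {ν : Measure X} {μ : Measure Y} [SFinite ν] [SFinite μ] {f : Y → ℂ} {k : X → ℝ≥0∞}
    {F : X → Y → ℝ≥0∞} (hk : Measurable k) (hF : Measurable (Function.uncurry F)) {A : ℝ≥0∞}
    (hA : ∀ h, eLpNorm (F h) 2 μ ≤ A) (hf : ∀ x, ‖f x‖ₑ ≤ ∫⁻ h, k h * F h x ∂ν) :
    eLpNorm f 2 μ ≤ (∫⁻ h, k h ∂ν) * A := by
  have hsq : ∀ {g : Y → ℝ≥0∞}, eLpNorm g 2 μ = (∫⁻ x, g x ^ (2 : ℝ) ∂μ) ^ (1 / 2 : ℝ) := by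
    intro g
    rw [eLpNorm_eq_lintegral_rpow_enorm_toReal two_ne_zero ENNReal.ofNat_ne_top]
    simp
  -- Cauchy–Schwarz after splitting k as k^{1/2} k^{1/2}; Tonelli then puts the inner integral in x,
  -- where the hypothesis on F applies.
  have hCS : ∀ x, (∫⁻ h, k h * F h x ∂ν) ^ (2 : ℝ) ≤
      (∫⁻ h, k h ∂ν) * ∫⁻ h, k h * F h x ^ (2 : ℝ) ∂ν := by
    intro x
    have hFx : Measurable fun h => F h x := hF.of_uncurry_right
    have h1 := ENNReal.lintegral_mul_le_Lp_mul_Lq ν Real.HolderConjugate.two_two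
      (f := fun h => k h ^ (1 / 2 : ℝ)) (g := fun h => k h ^ (1 / 2 : ℝ) * F h x)
      (hk.pow_const _).aemeasurable ((hk.pow_const _).mul hFx).aemeasurable
    have e1 : ∀ h, ((fun h => k h ^ (1 / 2 : ℝ)) * fun h => k h ^ (1 / 2 : ℝ) * F h x) h =
        k h * F h x := by
      intro h
      simp only [Pi.mul_apply]
      rw [← mul_assoc, ← ENNReal.rpow_add_of_nonneg _ _ (by norm_num) (by norm_num)]
      norm_num
    have e2 : ∀ h, (k h ^ (1 / 2 : ℝ)) ^ (2 : ℝ) = k h := fun h => by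
      rw [← ENNReal.rpow_mul]; norm_num
    simp only [e1, ENNReal.mul_rpow_of_nonneg _ _ (zero_le_two (α := ℝ)), e2] at h1
    calc (∫⁻ h, k h * F h x ∂ν) ^ (2 : ℝ) ≤ _ := ENNReal.rpow_le_rpow h1 zero_le_two
      _ = _ := by
        rw [ENNReal.mul_rpow_of_nonneg _ _ zero_le_two, ← ENNReal.rpow_mul, ← ENNReal.rpow_mul]
        norm_num
  have hA2 : ∀ h, ∫⁻ x, F h x ^ (2 : ℝ) ∂μ ≤ A ^ (2 : ℝ) := by
    intro h
    have := ENNReal.rpow_le_rpow (hA h) (zero_le_two (α := ℝ))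
    rwa [hsq, ← ENNReal.rpow_mul, one_div_mul_cancel two_ne_zero, ENNReal.rpow_one] at this
  have hmeas : Measurable fun q : Y × X => k q.2 * F q.2 q.1 ^ (2 : ℝ) :=
    (hk.comp measurable_snd).mul ((hF.comp measurable_swap).pow_const _)
  have hmain : ∫⁻ x, ‖f x‖ₑ ^ (2 : ℝ) ∂μ ≤ ((∫⁻ h, k h ∂ν) * A) ^ (2 : ℝ) := by
    calc ∫⁻ x, ‖f x‖ₑ ^ (2 : ℝ) ∂μ
        ≤ ∫⁻ x, (∫⁻ h, k h ∂ν) * ∫⁻ h, k h * F h x ^ (2 : ℝ) ∂ν ∂μ :=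
          lintegral_mono fun x => (ENNReal.rpow_le_rpow (hf x) zero_le_two).trans (hCS x)
      _ = (∫⁻ h, k h ∂ν) * ∫⁻ x, ∫⁻ h, k h * F h x ^ (2 : ℝ) ∂ν ∂μ :=
          lintegral_const_mul _ hmeas.lintegral_prod_right'
      _ = (∫⁻ h, k h ∂ν) * ∫⁻ h, ∫⁻ x, k h * F h x ^ (2 : ℝ) ∂μ ∂ν := by
          rw [lintegral_lintegral_swap hmeas.aemeasurable]
      _ = (∫⁻ h, k h ∂ν) * ∫⁻ h, k h * ∫⁻ x, F h x ^ (2 : ℝ) ∂μ ∂ν := by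
          congr 1
          refine lintegral_congr fun h => ?_
          exact lintegral_const_mul _ (hF.of_uncurry_left.pow_const _)
      _ ≤ (∫⁻ h, k h ∂ν) * ∫⁻ h, k h * A ^ (2 : ℝ) ∂ν := by
          gcongr with h
          exact hA2 h
      _ = _ := by
          rw [lintegral_mul_const _ hk, ENNReal.mul_rpow_of_nonneg _ _ zero_le_two, ← mul_assoc,
            ENNReal.rpow_two, ENNReal.rpow_two, ← sq]
  rw [eLpNorm_eq_lintegral_rpow_enorm_toReal two_ne_zero ENNReal.ofNat_ne_top]
  have := ENNReal.rpow_le_rpow hmain (by norm_num : (0 : ℝ) ≤ 1 / 2)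
  rw [← ENNReal.rpow_mul] at this
  norm_num at this
  simpa using this

variable {d : ℕ}

theorem enorm_correlation_le (K : 𝓢(Rd d, ℂ)) (f : Rd d → ℂ) (x : Rd d) :
    ‖correlation K f x‖ₑ ≤ ∫⁻ h, ‖K h‖ₑ * ‖f (h + x)‖ₑ := by
  have h1 : correlation K f x = ∫ h, K h * f (h + x) := by
    rw [← integral_sub_right_eq_self (μ := volume) (fun h : Rd d => (K h * f (h + x) : ℂ)) x]
    simp [correlation]
  rw [h1]
  refine (enorm_integral_le_lintegral_enorm _).trans (le_of_eq ?_)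
  simp only [enorm_mul]

theorem eLpNorm_correlation_two_le (K : 𝓢(Rd d, ℂ)) {f : Rd d → ℂ} (hf : Continuous f) :
    eLpNorm (correlation K f) 2 volume ≤ (∫⁻ h, ‖K h‖ₑ) * eLpNorm f 2 volume := by
  refine eLpNorm_two_le_of_enorm_le_lintegral (F := fun h x => ‖f (h + x)‖ₑ)
    K.continuous.measurable.enorm ?_ (fun h => ?_) (enorm_correlation_le K f)
  · exact ((hf.comp (continuous_fst.add continuous_snd)).measurable).enorm
  · rw [eLpNorm_enorm]
    exact (eLpNorm_comp_measurePreserving (g := f) hf.aestronglyMeasurable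
      (measurePreserving_add_left volume h)).le

theorem enorm_correlation_le_eLpNorm_top (K : 𝓢(Rd d, ℂ)) (f : Rd d → ℂ) (x : Rd d) :
    ‖correlation K f x‖ₑ ≤ (∫⁻ h, ‖K h‖ₑ) * eLpNorm f ∞ volume := by
  refine (enorm_correlation_le K f x).trans ?_
  rw [← lintegral_mul_const _ K.continuous.measurable.enorm]
  refine lintegral_mono_ae ?_
  have h1 : ∀ᵐ y, ‖f y‖ₑ ≤ eLpNorm f ∞ volume := by
    rw [eLpNorm_exponent_top]; exact ae_le_eLpNormEssSup
  filter_upwards [(measurePreserving_add_right volume x).quasiMeasurePreserving.ae h1] with h hh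
  gcongr

/-- Hölder with |K| = |K|^{1-1/p} |K|^{1/p}, then |K| ≤ M in the second factor. Only the L¹ and sup
norms of the kernel enter, and both scale explicitly under dilation. -/
theorem enorm_correlation_le_eLpNorm {p : ℝ} (hp : 1 ≤ p) (K : 𝓢(Rd d, ℂ)) {M : ℝ≥0∞}
    (hM : ∀ y, ‖K y‖ₑ ≤ M) {f : Rd d → ℂ} (hf : Continuous f) (x : Rd d) :
    ‖correlation K f x‖ₑ ≤
      (∫⁻ h, ‖K h‖ₑ) ^ (1 - 1 / p) * M ^ (1 / p) * eLpNorm f (ENNReal.ofReal p) volume := by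
  have hp0 : 0 < p := by linarith
  have hKm : Measurable fun h => ‖K h‖ₑ := K.continuous.measurable.enorm
  have hfm : Measurable fun h => ‖f (h + x)‖ₑ :=
    (hf.comp (continuous_add_const x)).measurable.enorm
  have hnorm : eLpNorm f (ENNReal.ofReal p) volume = (∫⁻ h, ‖f (h + x)‖ₑ ^ p) ^ (1 / p) := by
    rw [eLpNorm_eq_lintegral_rpow_enorm_toReal (by simpa using hp0) ENNReal.ofReal_ne_top,
      ENNReal.toReal_ofReal hp0.le, ← lintegral_add_right_eq_self _ x]
  have key : ∫⁻ h, ‖K h‖ₑ * ‖f (h + x)‖ₑ ≤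
      (∫⁻ h, ‖K h‖ₑ) ^ (1 - 1 / p) * (∫⁻ h, ‖K h‖ₑ * ‖f (h + x)‖ₑ ^ p) ^ (1 / p) := by
    rcases eq_or_lt_of_le hp with rfl | hp1
    · simp
    have hpq := Real.HolderConjugate.conjExponent hp1
    have h1 := ENNReal.lintegral_mul_le_Lp_mul_Lq volume hpq.symm
      (f := fun h => ‖K h‖ₑ ^ (1 - 1 / p)) (g := fun h => ‖K h‖ₑ ^ (1 / p) * ‖f (h + x)‖ₑ)
      (hKm.pow_const _).aemeasurable ((hKm.pow_const _).mul hfm).aemeasurable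
    have hq : (1 - 1 / p) * p.conjExponent = 1 := by
      rw [Real.conjExponent]; field_simp
    have hq' : 1 / p.conjExponent = 1 - 1 / p := by
      have : p.conjExponent ≠ 0 := hpq.symm.ne_zero
      field_simp at hq ⊢; linarith
    have h1p : 1 / p ≤ 1 := by rw [div_le_one hp0]; exact hp
    have e1 : ∀ h, ((fun h => ‖K h‖ₑ ^ (1 - 1 / p)) * fun h => ‖K h‖ₑ ^ (1 / p) * ‖f (h + x)‖ₑ) h =
        ‖K h‖ₑ * ‖f (h + x)‖ₑ := by
      intro h
      simp only [Pi.mul_apply]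
      rw [← mul_assoc, ← ENNReal.rpow_add_of_nonneg _ _ (by linarith) (by positivity)]
      simp
    have e2 : ∀ h, (‖K h‖ₑ ^ (1 - 1 / p)) ^ p.conjExponent = ‖K h‖ₑ := fun h => by
      rw [← ENNReal.rpow_mul, hq, ENNReal.rpow_one]
    have e3 : ∀ h, (‖K h‖ₑ ^ (1 / p) * ‖f (h + x)‖ₑ) ^ p = ‖K h‖ₑ * ‖f (h + x)‖ₑ ^ p := fun h => by
      rw [ENNReal.mul_rpow_of_nonneg _ _ hp0.le, ← ENNReal.rpow_mul, one_div_mul_cancel hp0.ne',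
        ENNReal.rpow_one]
    simp only [e1, e2, e3, hq'] at h1
    exact h1
  refine (enorm_correlation_le K f x).trans (key.trans ?_)
  rw [mul_assoc, hnorm, ← ENNReal.mul_rpow_of_nonneg _ _ (by positivity),
    ← lintegral_const_mul _ (hfm.pow_const p)]
  gcongr with h
  exact hM h

/-- Interpolation between `L^p` and `L^∞`. -/
theorem eLpNorm_le_of_enorm_le {p q : ℝ≥0∞} (hp0 : p ≠ 0) (hpq : p ≤ q) (hp : p ≠ ⊤)
    {f : Rd d → ℂ} (hf : Continuous f) {M : ℝ≥0∞} (hM : ∀ x, ‖f x‖ₑ ≤ M * eLpNorm f p volume) :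
    eLpNorm f q volume ≤ M ^ (1 - p.toReal / q.toReal) * eLpNorm f p volume := by
  rcases eq_or_ne q ⊤ with rfl | hq
  -- With q = ⊤ the conventions `toReal ⊤ = 0` and `x / 0 = 0` make the exponent 1, in agreement
  -- with 1 - p/∞.
  · simp only [ENNReal.toReal_top, div_zero, sub_zero, ENNReal.rpow_one, eLpNorm_exponent_top]
    exact eLpNormEssSup_le_of_ae_enorm_bound (Eventually.of_forall hM)
  have hp0' : 0 < p.toReal := ENNReal.toReal_pos hp0 hp
  have hpq' : p.toReal ≤ q.toReal := ENNReal.toReal_mono hq hpq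
  have hq0' : 0 < q.toReal := hp0'.trans_le hpq'
  have hq0 : q ≠ 0 := fun h => by simp [h] at hq0'
  set N := eLpNorm f p volume with hN
  have hNp : N ^ p.toReal = ∫⁻ x, ‖f x‖ₑ ^ p.toReal := by
    rw [hN, eLpNorm_eq_lintegral_rpow_enorm_toReal hp0 hp, ← ENNReal.rpow_mul,
      one_div_mul_cancel hp0'.ne', ENNReal.rpow_one]
  have h1 : ∫⁻ x, ‖f x‖ₑ ^ q.toReal ≤ (M * N) ^ (q.toReal - p.toReal) * N ^ p.toReal := by
    rw [hNp, ← lintegral_const_mul _ (hf.measurable.enorm.pow_const _)]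
    refine lintegral_mono fun x => ?_
    calc ‖f x‖ₑ ^ q.toReal = ‖f x‖ₑ ^ (q.toReal - p.toReal) * ‖f x‖ₑ ^ p.toReal := by
          rw [← ENNReal.rpow_add_of_nonneg _ _ (by linarith) hp0'.le, sub_add_cancel]
      _ ≤ _ := by
          gcongr
          exact hM x
  rw [eLpNorm_eq_lintegral_rpow_enorm_toReal hq0 hq]
  refine (ENNReal.rpow_le_rpow h1 (by positivity)).trans (le_of_eq ?_)
  have hd : 0 ≤ q.toReal - p.toReal := by linarith
  rw [ENNReal.mul_rpow_of_nonneg _ _ hd, mul_assoc,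
    ← ENNReal.rpow_add_of_nonneg _ _ hd hp0'.le, sub_add_cancel,
    ENNReal.mul_rpow_of_nonneg _ _ (by positivity), ← ENNReal.rpow_mul, ← ENNReal.rpow_mul,
    mul_one_div_cancel hq0'.ne', ENNReal.rpow_one]
  congr 2
  field_simp

theorem SchwartzMap.integrable_sub_mul (K : 𝓢(Rd d, ℂ)) {f : Rd d → ℂ} (hf : Continuous f)
    {B : ℝ} {k : ℕ} (hB : ∀ y, ‖f y‖ ≤ B * (1 + ‖y‖) ^ k) (x : Rd d) :
    Integrable fun y => K (y - x) * f y := by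
  refine ((K.integrable_one_add_norm_pow_mul k x).const_mul B).mono'
    (((K.continuous.comp (continuous_sub_right x)).mul hf).aestronglyMeasurable)
    (Eventually.of_forall fun y => ?_)
  rw [norm_mul]
  calc ‖K (y - x)‖ * ‖f y‖ ≤ ‖K (y - x)‖ * (B * (1 + ‖y‖) ^ k) := by gcongr; exact hB y
    _ = _ := by ring

theorem integrable_sub_mul_schwartzMultiplier (K a : 𝓢(Rd d, ℂ)) (T : 𝓢'(Rd d, ℂ)) (x : Rd d) :
    Integrable fun y => K (y - x) * schwartzMultiplier a T y := by
  obtain ⟨k, B, -, hB⟩ := exists_norm_schwartzMultiplier_le a T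
  exact K.integrable_sub_mul (continuous_schwartzMultiplier a T) hB x

theorem integrable_sub_mul_schwartzMultiplier_mul (K a b : 𝓢(Rd d, ℂ)) (T S : 𝓢'(Rd d, ℂ))
    (x : Rd d) :
    Integrable fun y => K (y - x) * (schwartzMultiplier a T y * schwartzMultiplier b S y) := by
  obtain ⟨k, B, hB0, hB⟩ := exists_norm_schwartzMultiplier_le a T
  obtain ⟨k', B', hB0', hB'⟩ := exists_norm_schwartzMultiplier_le b S
  refine K.integrable_sub_mul (B := B * B') (k := k + k')
    ((continuous_schwartzMultiplier a T).mul (continuous_schwartzMultiplier b S)) (fun y => ?_) x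
  rw [Pi.mul_apply, norm_mul]
  calc _ ≤ (B * (1 + ‖y‖) ^ k) * (B' * (1 + ‖y‖) ^ k') := by gcongr; exacts [hB y, hB' y]
    _ = _ := by ring

theorem enorm_schwartzMultiplier_sub_le (a : 𝓢(Rd d, ℂ)) (T : 𝓢'(Rd d, ℂ)) (x h : Rd d) :
    ‖schwartzMultiplier a T x - schwartzMultiplier a T (h + x)‖ₑ ≤
      ‖h‖ₑ * ∫⁻ t in Set.Icc (0 : ℝ) 1,
        ∑ i, ‖schwartzMultiplier a (LPCutoff.partialD i T) (x + (1 - t) • h)‖ₑ := by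
  have hcont : ∀ i, Continuous (schwartzMultiplier a (LPCutoff.partialD i T)) :=
    fun i => continuous_schwartzMultiplier _ _
  rw [schwartzMultiplier_sub_eq_integral, ← lintegral_const_mul]
  · refine (enorm_integral_le_lintegral_enorm _).trans (lintegral_mono fun t => ?_)
    rw [Finset.mul_sum]
    refine (enorm_sum_le _ _).trans (Finset.sum_le_sum fun i _ => ?_)
    rw [enorm_mul, show h + x + t • (x - (h + x)) = x + (1 - t) • h by module]
    gcongr
    rw [enorm_le_iff_norm_le, Complex.norm_real, ← norm_neg h]
    simpa using PiLp.norm_apply_le (x - (h + x)) i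
  · exact Finset.measurable_sum _ fun i _ =>
      ((hcont i).comp (by fun_prop : Continuous fun t : ℝ => x + (1 - t) • h)).measurable.enorm

/-- Hölder, Minkowski and translation invariance. The bound does not see the shifts u and v, so it
can be integrated against a kernel depending on them. -/
theorem eLpNorm_sum_mul_comp_add_le {ι : Type*} (s : Finset ι) {q r : ℝ≥0∞}
    [ENNReal.HolderTriple q r 2] (hq : 1 ≤ q) {W : ι → Rd d → ℂ} (hW : ∀ i, Continuous (W i))
    {Z : Rd d → ℂ} (hZ : Continuous Z) (u v : Rd d) :
    eLpNorm (fun x => (∑ i ∈ s, ‖W i (x + u)‖ₑ) * ‖Z (v + x)‖ₑ) 2 volume ≤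
      (∑ i ∈ s, eLpNorm (W i) q volume) * eLpNorm Z r volume := by
  set φ : Rd d → ℝ := fun x => ∑ i ∈ s, ‖W i (x + u)‖ with hφ
  have hφc : Continuous φ := by fun_prop
  calc _ = eLpNorm (φ • fun x => Z (v + x)) 2 volume := by
        refine eLpNorm_congr_enorm_ae (Eventually.of_forall fun x => ?_)
        simp only [Pi.smul_apply', enorm_smul, hφ, enorm_eq_self]
        congr 1
        rw [Real.enorm_of_nonneg (Finset.sum_nonneg fun _ _ => norm_nonneg _),
          ENNReal.ofReal_sum_of_nonneg fun _ _ => norm_nonneg _]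
        simp
    _ ≤ eLpNorm φ q volume * eLpNorm (fun x => Z (v + x)) r volume :=
        eLpNorm_smul_le_mul_eLpNorm (hZ.comp (continuous_const_add v)).aestronglyMeasurable
          hφc.aestronglyMeasurable
    _ ≤ _ := by
        gcongr
        · have h1 : φ = ∑ i ∈ s, fun x => ‖W i (x + u)‖ := by ext x; simp [hφ]
          rw [h1]
          refine (eLpNorm_sum_le (fun i _ => ?_) hq).trans (Finset.sum_le_sum fun i _ => ?_)
          · exact ((hW i).comp (continuous_add_const u)).norm.aestronglyMeasurable
          · rw [eLpNorm_norm]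
            exact (eLpNorm_comp_measurePreserving (g := W i) (hW i).aestronglyMeasurable
              (measurePreserving_add_right volume u)).le
        · exact (eLpNorm_comp_measurePreserving (g := Z) hZ.aestronglyMeasurable
            (measurePreserving_add_left volume v)).le

/-- The commutator of a convolution operator and the multiplication by a smooth function gains one
derivative. -/
theorem eLpNorm_commutator_le (K a b : 𝓢(Rd d, ℂ)) (T S : 𝓢'(Rd d, ℂ)) {q r : ℝ≥0∞}
    [ENNReal.HolderTriple q r 2] (hq : 1 ≤ q) :
    eLpNorm (fun x => schwartzMultiplier a T x * correlation K (schwartzMultiplier b S) x -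
        correlation K (fun y => schwartzMultiplier a T y * schwartzMultiplier b S y) x) 2 volume ≤
      (∫⁻ h, ‖K h‖ₑ * ‖h‖ₑ) * ((∑ i, eLpNorm (schwartzMultiplier a (LPCutoff.partialD i T)) q volume)
        * eLpNorm (schwartzMultiplier b S) r volume) := by
  set W := schwartzMultiplier a T with hW
  set Z := schwartzMultiplier b S with hZ
  have hWc : Continuous W := continuous_schwartzMultiplier a T
  have hZc : Continuous Z := continuous_schwartzMultiplier b S
  have hWi : ∀ i, Continuous (schwartzMultiplier a (LPCutoff.partialD i T)) :=
    fun i => continuous_schwartzMultiplier _ _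
  -- The commutator is a superposition over the displacement h and the position t on the segment
  -- from h + x to x. The weight |K(h)| |h| does not depend on t, so its total mass is the first
  -- moment of K.
  let ν : Measure (Rd d × ℝ) := volume.prod (volume.restrict (Set.Icc (0 : ℝ) 1))
  have hk : Measurable fun h : Rd d => ‖K h‖ₑ * ‖h‖ₑ :=
    K.continuous.measurable.enorm.mul measurable_id.enorm
  have hk' : Measurable fun h : Rd d × ℝ => ‖K h.1‖ₑ * ‖h.1‖ₑ := hk.comp measurable_fst
  have hνk : ∫⁻ h : Rd d × ℝ, ‖K h.1‖ₑ * ‖h.1‖ₑ ∂ν = ∫⁻ h, ‖K h‖ₑ * ‖h‖ₑ := by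
    rw [lintegral_prod _ hk'.aemeasurable]
    simp
  have hFm : Measurable (Function.uncurry fun (h : Rd d × ℝ) (x : Rd d) =>
      (∑ i, ‖schwartzMultiplier a (LPCutoff.partialD i T) (x + (1 - h.2) • h.1)‖ₑ) *
        ‖Z (h.1 + x)‖ₑ) := by
    refine Measurable.mul (Finset.measurable_sum _ fun i _ => ?_) ?_
    · exact ((hWi i).comp (by fun_prop : Continuous fun h : (Rd d × ℝ) × Rd d =>
        h.2 + (1 - h.1.2) • h.1.1)).measurable.enorm
    · exact (hZc.comp (by fun_prop : Continuous fun h : (Rd d × ℝ) × Rd d =>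
        h.1.1 + h.2)).measurable.enorm
  rw [← hνk]
  refine eLpNorm_two_le_of_enorm_le_lintegral (ν := ν) hk' hFm
    (fun h => eLpNorm_sum_mul_comp_add_le _ hq hWi hZc _ _) fun x => ?_
  have h1 : W x * correlation K Z x - correlation K (fun y => W y * Z y) x =
      ∫ h, K h * ((W x - W (h + x)) * Z (h + x)) := by
    rw [← integral_sub_right_eq_self (μ := volume)
      (fun h : Rd d => (K h * ((W x - W (h + x)) * Z (h + x)) : ℂ)) x, correlation, correlation,
      ← integral_const_mul, ← integral_sub]
    · refine integral_congr_ae (Eventually.of_forall fun y => ?_)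
      simp only [sub_add_cancel]
      ring
    · exact (integrable_sub_mul_schwartzMultiplier K b S x).const_mul _
    · exact integrable_sub_mul_schwartzMultiplier_mul K a b T S x
  have hkF : Measurable fun h : Rd d × ℝ => ‖K h.1‖ₑ * ‖h.1‖ₑ *
      ((∑ i, ‖schwartzMultiplier a (LPCutoff.partialD i T) (x + (1 - h.2) • h.1)‖ₑ) *
        ‖Z (h.1 + x)‖ₑ) := hk'.mul hFm.of_uncurry_right
  rw [h1, lintegral_prod _ hkF.aemeasurable]
  refine (enorm_integral_le_lintegral_enorm _).trans (lintegral_mono fun h => ?_)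
  have hm : Measurable fun t : ℝ =>
      ∑ i, ‖schwartzMultiplier a (LPCutoff.partialD i T) (x + (1 - t) • h)‖ₑ :=
    Finset.measurable_sum _ fun i _ =>
      ((hWi i).comp (by fun_prop : Continuous fun t : ℝ => x + (1 - t) • h)).measurable.enorm
  dsimp only
  rw [lintegral_const_mul _ (hm.mul_const _), lintegral_mul_const _ hm, enorm_mul, enorm_mul]
  rw [mul_assoc, ← mul_assoc ‖h‖ₑ]
  gcongr
  exact enorm_schwartzMultiplier_sub_le a T x h

end LpEstimates

/-! ### Kernels of compactly supported symbols and their scaling -/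

section Kernel

variable {d : ℕ}

namespace CompactSymbol

/-- A compactly supported symbol, as a Schwartz function. -/
def toSchwartz (m : CompactSymbol d) : 𝓢(Rd d, ℂ) :=
  HasCompactSupport.toSchwartzMap (f := fun ξ => (m.toFun ξ : ℂ))
    (m.compact.comp_left (g := fun r : ℝ => (r : ℂ)) Complex.ofReal_zero)
    (Complex.ofRealCLM.contDiff.comp m.smooth)

@[simp]
theorem toSchwartz_apply (m : CompactSymbol d) (ξ : Rd d) : m.toSchwartz ξ = m.toFun ξ := rfl

theorem fourier_waveTest (m : CompactSymbol d) (x : Rd d) :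
    𝓕 (m.waveTest x) = (𝓕 m.toSchwartz).compSubConstCLM ℂ x := by
  ext y
  rw [SchwartzMap.compSubConstCLM_apply, SchwartzMap.fourier_coe, SchwartzMap.fourier_coe,
    Real.fourier_eq', Real.fourier_eq']
  refine integral_congr_ae (Eventually.of_forall fun v => ?_)
  change _ • ((m.toFun v : ℂ) * Complex.exp (2 * Real.pi * Complex.I * (inner ℝ x v : ℝ))) =
    _ • (m.toFun v : ℂ)
  simp only [smul_eq_mul]
  rw [mul_comm (m.toFun v : ℂ), ← mul_assoc, ← Complex.exp_add, inner_sub_right,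
    real_inner_comm v x]
  congr 2
  push_cast
  ring

theorem apply_eq_schwartzMultiplier (m : CompactSymbol d) (f : 𝓢'(Rd d, ℂ)) :
    m.apply f = schwartzMultiplier m.toSchwartz f := by
  funext x
  rw [CompactSymbol.apply, TemperedDistribution.fourier_apply, fourier_waveTest]
  rfl

/-- The convolution kernel of a multiplier, up to reflection. -/
def kernel (m : CompactSymbol d) : 𝓢(Rd d, ℂ) := 𝓕 m.toSchwartz

theorem kernel_dilate_apply (m : CompactSymbol d) {a : ℝ} (ha : 0 < a) (y : Rd d) :
    (m.dilate a ha.ne').kernel y = ((a ^ d)⁻¹ : ℝ) • m.kernel (a⁻¹ • y) := by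
  rw [kernel, kernel, SchwartzMap.fourier_coe, SchwartzMap.fourier_coe, Real.fourier_eq',
    Real.fourier_eq']
  have h := Measure.integral_comp_smul volume (fun v : Rd d =>
    Complex.exp ((-2 * Real.pi * inner ℝ v (a⁻¹ • y) : ℝ) * Complex.I) • m.toSchwartz v) a
  rw [finrank_euclideanSpace_fin, abs_of_pos (by positivity)] at h
  rw [← h]
  refine integral_congr_ae (Eventually.of_forall fun v => ?_)
  simp only [real_inner_smul_left, real_inner_smul_right, inv_mul_cancel_left₀ ha.ne']
  rfl

/-- Dilating the symbol preserves the L¹ norm of the kernel, and each factor |h| brings out one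
power of a. The case k = 0 makes dyadic bounds uniform in j; k = 1 produces the gain 2^{-j} of the
commutator. -/
theorem lintegral_kernel_dilate (m : CompactSymbol d) {a : ℝ} (ha : 0 < a) (k : ℕ) :
    ∫⁻ h, ‖(m.dilate a ha.ne').kernel h‖ₑ * ‖h‖ₑ ^ k =
      ENNReal.ofReal a ^ k * ∫⁻ h, ‖m.kernel h‖ₑ * ‖h‖ₑ ^ k := by
  have h1 : ∀ K : 𝓢(Rd d, ℂ), ∫⁻ h, ‖K h‖ₑ * ‖h‖ₑ ^ k =
      ENNReal.ofReal (∫ h, ‖h‖ ^ k * ‖K h‖) := by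
    intro K
    rw [ofReal_integral_eq_lintegral_ofReal (K.integrable_pow_mul volume k)
      (Eventually.of_forall fun h => by positivity)]
    refine lintegral_congr fun h => ?_
    rw [ENNReal.ofReal_mul (by positivity), ENNReal.ofReal_pow (by positivity), ofReal_norm,
      ofReal_norm, mul_comm]
  rw [h1, h1, ← ENNReal.ofReal_pow ha.le, ← ENNReal.ofReal_mul (by positivity)]
  congr 1
  have h2 := Measure.integral_comp_inv_smul volume
    (fun h : Rd d => (a ^ k * (a ^ d)⁻¹) * (‖h‖ ^ k * ‖m.kernel h‖)) a
  rw [finrank_euclideanSpace_fin, abs_of_pos (by positivity)] at h2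
  have h3 : ∀ h : Rd d, ‖h‖ ^ k * ‖(m.dilate a ha.ne').kernel h‖ =
      (a ^ k * (a ^ d)⁻¹) * (‖a⁻¹ • h‖ ^ k * ‖m.kernel (a⁻¹ • h)‖) := by
    intro h
    rw [kernel_dilate_apply m ha, norm_smul, norm_smul,
      Real.norm_of_nonneg (by positivity : 0 ≤ (a ^ d)⁻¹), Real.norm_of_nonneg (inv_nonneg.2 ha.le),
      mul_pow, inv_pow]
    have : a ^ k ≠ 0 := by positivity
    calc ‖h‖ ^ k * ((a ^ d)⁻¹ * ‖m.kernel (a⁻¹ • h)‖)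
        = (a ^ k * (a ^ k)⁻¹) * (‖h‖ ^ k * ((a ^ d)⁻¹ * ‖m.kernel (a⁻¹ • h)‖)) := by
          rw [mul_inv_cancel₀ this, one_mul]
      _ = _ := by ring
  simp only [h3]
  rw [h2, smul_eq_mul, integral_const_mul]
  field_simp

theorem lintegral_kernel_lt_top (m : CompactSymbol d) (k : ℕ) :
    ∫⁻ h, ‖m.kernel h‖ₑ * ‖h‖ₑ ^ k < ⊤ := by
  have := (m.kernel.integrable_pow_mul volume k).hasFiniteIntegral
  refine lt_of_le_of_lt (lintegral_mono fun h => ?_) this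
  rw [enorm_mul, enorm_pow, enorm_norm, enorm_norm, mul_comm]

theorem exists_enorm_kernel_dilate_le (m : CompactSymbol d) :
    ∃ M : ℝ≥0∞, M ≠ ⊤ ∧ ∀ (a : ℝ) (ha : 0 < a) (y : Rd d),
      ‖(m.dilate a ha.ne').kernel y‖ₑ ≤ ENNReal.ofReal ((a ^ d)⁻¹) * M := by
  obtain ⟨B, hB0, hB⟩ := m.kernel.exists_norm_iteratedFDeriv_le 0
  refine ⟨ENNReal.ofReal B, ENNReal.ofReal_ne_top, fun a ha y => ?_⟩
  rw [kernel_dilate_apply m ha, enorm_smul, Real.enorm_of_nonneg (by positivity)]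
  gcongr
  rw [← ofReal_norm]
  exact ENNReal.ofReal_le_ofReal (by simpa using hB (a⁻¹ • y))

end CompactSymbol

end Kernel

/-! ### Dyadic blocks: frequency supports and telescoping -/

section Blocks

variable {d : ℕ}

/-- The dilation factor `2^{-j} 2π` of the dyadic symbols. -/
def dyadicScale (j : ℤ) : ℝ := (2 : ℝ) ^ (-j) * (2 * Real.pi)

theorem dyadicScale_pos (j : ℤ) : 0 < dyadicScale j := by unfold dyadicScale; positivity

theorem dyadicScale_eq_mul (i j : ℤ) : dyadicScale i = (2 : ℝ) ^ (j - i) * dyadicScale j := by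
  rw [dyadicScale, dyadicScale, ← mul_assoc ((2 : ℝ) ^ (j - i)), ← zpow_add₀ two_ne_zero]
  congr 2
  ring

namespace LPCutoff

variable (χ : LPCutoff d)

/-- The symbol of `Δ̇_j`. -/
def blockSymbol (j : ℤ) : CompactSymbol d := χ.phi.dilate (dyadicScale j) (dyadicScale_pos j).ne'

/-- The symbol of `Ṡ_j`. -/
def lowSymbol (j : ℤ) : CompactSymbol d := χ.chi.dilate (dyadicScale j) (dyadicScale_pos j).ne'

theorem blockSymbol_apply (j : ℤ) (ξ : Rd d) :
    (χ.blockSymbol j).toFun ξ = χ.phi.toFun (dyadicScale j • ξ) := rfl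

theorem lowSymbol_apply (j : ℤ) (ξ : Rd d) :
    (χ.lowSymbol j).toFun ξ = χ.toFun (dyadicScale j • ξ) := rfl

theorem block_eq (j : ℤ) (f : 𝓢'(Rd d, ℂ)) :
    χ.block j f = schwartzMultiplier (χ.blockSymbol j).toSchwartz f :=
  CompactSymbol.apply_eq_schwartzMultiplier _ f

theorem lowCut_eq (j : ℤ) (f : 𝓢'(Rd d, ℂ)) :
    χ.lowCut j f = schwartzMultiplier (χ.lowSymbol j).toSchwartz f :=
  CompactSymbol.apply_eq_schwartzMultiplier _ f

theorem continuous_block (j : ℤ) (f : 𝓢'(Rd d, ℂ)) : Continuous (χ.block j f) := by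
  rw [block_eq]; exact continuous_schwartzMultiplier _ _

theorem continuous_lowCut (j : ℤ) (f : 𝓢'(Rd d, ℂ)) : Continuous (χ.lowCut j f) := by
  rw [lowCut_eq]; exact continuous_schwartzMultiplier _ _

theorem eq_one_of_norm_le {ξ : Rd d} (h : ‖ξ‖ ≤ 3 / 4) : χ.toFun ξ = 1 :=
  χ.eq_one ξ (by simpa using h)

theorem eq_zero_of_le_norm {ξ : Rd d} (h : 4 / 3 ≤ ‖ξ‖) : χ.toFun ξ = 0 := by
  by_contra h0
  have := χ.tsupport_subset (subset_tsupport _ h0)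
  rw [mem_ball_zero_iff] at this
  linarith

theorem phi_apply (ξ : Rd d) : χ.phi.toFun ξ = χ.toFun ((2 : ℝ)⁻¹ • ξ) - χ.toFun ξ := rfl

theorem norm_inv_two_smul (ξ : Rd d) : ‖(2 : ℝ)⁻¹ • ξ‖ = ‖ξ‖ / 2 := by
  rw [norm_smul, norm_inv, Real.norm_ofNat]; ring

/-- Both terms of φ equal 1 inside the inner radius 3/4, and both vanish outside the radius 2 · 4/3
= 8/3. -/
theorem norm_mem_of_phi_ne_zero {ξ : Rd d} (h : χ.phi.toFun ξ ≠ 0) :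
    3 / 4 < ‖ξ‖ ∧ ‖ξ‖ < 8 / 3 := by
  rw [phi_apply] at h
  constructor
  · by_contra hle
    rw [not_lt] at hle
    refine h ?_
    rw [χ.eq_one_of_norm_le hle, χ.eq_one_of_norm_le, sub_self]
    rw [norm_inv_two_smul]
    linarith [norm_nonneg ξ]
  · by_contra hle
    rw [not_lt] at hle
    refine h ?_
    rw [χ.eq_zero_of_le_norm (ξ := ξ) (by linarith), χ.eq_zero_of_le_norm, sub_self]
    rw [norm_inv_two_smul]
    linarith

theorem norm_dyadicScale_smul (j : ℤ) (ξ : Rd d) : ‖dyadicScale j • ξ‖ = dyadicScale j * ‖ξ‖ := by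
  rw [norm_smul, Real.norm_of_nonneg (dyadicScale_pos j).le]

/-- The frequency annulus of `Δ̇_i`, measured at the scale of `Δ̇_j`. -/
theorem norm_mem_of_blockSymbol_ne_zero {i : ℤ} (j : ℤ) {ξ : Rd d}
    (h : (χ.blockSymbol i).toSchwartz ξ ≠ 0) :
    3 / 4 * (2 : ℝ) ^ (i - j) < dyadicScale j * ‖ξ‖ ∧
      dyadicScale j * ‖ξ‖ < 8 / 3 * (2 : ℝ) ^ (i - j) := by
  rw [CompactSymbol.toSchwartz_apply, Complex.ofReal_ne_zero, blockSymbol_apply] at h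
  have h1 := χ.norm_mem_of_phi_ne_zero h
  rw [norm_dyadicScale_smul] at h1
  rw [dyadicScale_eq_mul j i, mul_assoc]
  have : (0 : ℝ) < 2 ^ (i - j) := by positivity
  constructor <;> nlinarith [h1.1, h1.2]

theorem block_eq_sub (j : ℤ) (f : 𝓢'(Rd d, ℂ)) (x : Rd d) :
    χ.block j f x = χ.lowCut (j + 1) f x - χ.lowCut j f x := by
  rw [block_eq, lowCut_eq, lowCut_eq, ← schwartzMultiplier_sub]
  congr 1
  ext ξ
  simp only [CompactSymbol.toSchwartz_apply, blockSymbol_apply, phi_apply, lowSymbol_apply,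
    sub_apply, Complex.ofReal_sub]
  rw [smul_smul, dyadicScale_eq_mul (j + 1) j]
  simp

/-- Telescoping: blocks are consecutive differences of low-frequency cut-offs, and the upper cut-off
of index b includes only blocks of index less than b. -/
theorem sum_block_Ico {a b : ℤ} (hab : a ≤ b) (f : 𝓢'(Rd d, ℂ)) (x : Rd d) :
    ∑ i ∈ Finset.Ico a b, χ.block i f x = χ.lowCut b f x - χ.lowCut a f x := by
  induction b, hab using Int.leInduction with
  | base => simp
  | succ b hb ih =>
    rw [← Finset.insert_Ico_right_eq_Ico_add_one hb, Finset.sum_insert (by simp), ih, block_eq_sub]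
    ring

/-- On the annulus of index j the cut-off at N is 1, since (8/3)/4 ≤ 3/4, and the cut-off at M is 0,
since 2 · 3/4 ≥ 4/3. -/
theorem correlation_lowCut_sub_lowCut {j M N : ℤ} (hM : M ≤ j - 1) (hN : j + 2 ≤ N)
    (f : 𝓢'(Rd d, ℂ)) (x : Rd d) :
    correlation (χ.blockSymbol j).kernel (fun y => χ.lowCut N f y - χ.lowCut M f y) x =
      χ.block j f x := by
  have h1 : (fun y => χ.lowCut N f y - χ.lowCut M f y) =
      schwartzMultiplier ((χ.lowSymbol N).toSchwartz - (χ.lowSymbol M).toSchwartz) f := by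
    funext y
    rw [lowCut_eq, lowCut_eq, schwartzMultiplier_sub]
  rw [h1, block_eq]
  refine correlation_schwartzMultiplier _ _ _ (fun ξ => ?_) f x
  by_cases h0 : (χ.blockSymbol j).toSchwartz ξ = 0
  · rw [h0, zero_mul]
  have hξ := χ.norm_mem_of_blockSymbol_ne_zero j h0
  simp only [sub_self, zpow_zero, mul_one] at hξ
  have h2 : (χ.lowSymbol N).toFun ξ = 1 := by
    rw [lowSymbol_apply]
    refine χ.eq_one_of_norm_le ?_
    rw [norm_dyadicScale_smul, dyadicScale_eq_mul N j, mul_assoc]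
    have : (2 : ℝ) ^ (j - N) ≤ 2 ^ (-2 : ℤ) := zpow_le_zpow_right₀ one_le_two (by omega)
    have h3 : (2 : ℝ) ^ (-2 : ℤ) = 1 / 4 := by norm_num
    calc (2 : ℝ) ^ (j - N) * (dyadicScale j * ‖ξ‖) ≤ 1 / 4 * (8 / 3) := by
          rw [← h3]
          exact mul_le_mul this hξ.2.le (by linarith [hξ.1]) (by positivity)
      _ ≤ 3 / 4 := by norm_num
  have h3 : (χ.lowSymbol M).toFun ξ = 0 := by
    rw [lowSymbol_apply]
    refine χ.eq_zero_of_le_norm ?_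
    rw [norm_dyadicScale_smul, dyadicScale_eq_mul M j, mul_assoc]
    have : (2 : ℝ) ^ (1 : ℤ) ≤ 2 ^ (j - M) := zpow_le_zpow_right₀ one_le_two (by omega)
    rw [zpow_one] at this
    nlinarith [hξ.1, hξ.2]
  simp only [sub_apply, CompactSymbol.toSchwartz_apply, h2, h3]
  simp

theorem correlation_block_eq_zero {j l : ℤ} (h : l + 2 ≤ j ∨ j + 2 ≤ l) (f : 𝓢'(Rd d, ℂ))
    (x : Rd d) : correlation (χ.blockSymbol j).kernel (χ.block l f) x = 0 := by
  rw [block_eq]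
  have h1 := correlation_schwartzMultiplier (χ.blockSymbol l).toSchwartz
    (χ.blockSymbol j).toSchwartz 0 (fun ξ => ?_) f x
  · rw [CompactSymbol.kernel, h1]
    simpa using schwartzMultiplier_smul 0 (0 : 𝓢(Rd d, ℂ)) f x
  · by_contra hne
    obtain ⟨hj, hl⟩ := mul_ne_zero_iff.1 (Ne.symm hne)
    have h2 := χ.norm_mem_of_blockSymbol_ne_zero j hj
    have h3 := χ.norm_mem_of_blockSymbol_ne_zero j hl
    simp only [sub_self, zpow_zero, mul_one] at h2
    rcases h with h | h
    · have : (2 : ℝ) ^ (l - j) ≤ 2 ^ (-2 : ℤ) := zpow_le_zpow_right₀ one_le_two (by omega)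
      norm_num at this
      linarith [h3.2, h2.1]
    · have : (2 : ℝ) ^ (2 : ℤ) ≤ 2 ^ (l - j) := zpow_le_zpow_right₀ one_le_two (by omega)
      norm_num at this
      linarith [h3.1, h2.2]

/-- The triangle inequality for ξ = η + (ξ - η). In units of scale j, for i ≤ j - 2: |η| < 2/3 and
|ξ - η| < 1/12 add up to at most 3/4, below the annulus, while |ξ - η| > 24 is out of reach of 8/3 +
2/3. In units of scale i, when j ≤ i + 1: |ξ - η| > 12 exceeds 16/3 + 8/3. -/
theorem correlation_block_mul_block_eq_zero {j i l : ℤ}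
    (h : (i ≤ j - 2 ∧ (l ≤ j - 5 ∨ j + 5 ≤ l)) ∨ (j - 1 ≤ i ∧ i + 4 ≤ l))
    (w z : 𝓢'(Rd d, ℂ)) (x : Rd d) :
    correlation (χ.blockSymbol j).kernel (fun y => χ.block i w y * χ.block l z y) x = 0 := by
  simp only [block_eq]
  refine correlation_mul_eq_zero _ _ _ (fun ξ η => ?_) w z x
  by_contra hne
  push Not at hne
  obtain ⟨hj, hi, hl⟩ := hne
  have htri1 : ‖ξ - η‖ ≤ ‖ξ‖ + ‖η‖ := norm_sub_le _ _
  have htri2 : ‖ξ‖ ≤ ‖ξ - η‖ + ‖η‖ := by simpa using norm_add_le (ξ - η) η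
  rcases h with ⟨h1, h2⟩ | ⟨h1, h2⟩
  · have hj := χ.norm_mem_of_blockSymbol_ne_zero j hj
    have hi := χ.norm_mem_of_blockSymbol_ne_zero j hi
    have hl := χ.norm_mem_of_blockSymbol_ne_zero j hl
    simp only [sub_self, zpow_zero, mul_one] at hj
    have hpos := dyadicScale_pos j
    have e1 : (2 : ℝ) ^ (i - j) ≤ 2 ^ (-2 : ℤ) := zpow_le_zpow_right₀ one_le_two (by omega)
    norm_num at e1
    rcases h2 with h2 | h2
    · have e2 : (2 : ℝ) ^ (l - j) ≤ 2 ^ (-5 : ℤ) := zpow_le_zpow_right₀ one_le_two (by omega)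
      norm_num at e2
      have := mul_le_mul_of_nonneg_left htri2 hpos.le
      linarith [hj.1, hi.2, hl.2]
    · have e2 : (2 : ℝ) ^ (5 : ℤ) ≤ 2 ^ (l - j) := zpow_le_zpow_right₀ one_le_two (by omega)
      norm_num at e2
      have := mul_le_mul_of_nonneg_left htri1 hpos.le
      linarith [hj.2, hi.2, hl.1]
  · have hj := χ.norm_mem_of_blockSymbol_ne_zero i hj
    have hi := χ.norm_mem_of_blockSymbol_ne_zero i hi
    have hl := χ.norm_mem_of_blockSymbol_ne_zero i hl
    simp only [sub_self, zpow_zero, mul_one] at hi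
    have hpos := dyadicScale_pos i
    have e1 : (2 : ℝ) ^ (j - i) ≤ 2 ^ (1 : ℤ) := zpow_le_zpow_right₀ one_le_two (by omega)
    have e2 : (2 : ℝ) ^ (4 : ℤ) ≤ 2 ^ (l - i) := zpow_le_zpow_right₀ one_le_two (by omega)
    norm_num at e1 e2
    have := mul_le_mul_of_nonneg_left htri1 hpos.le
    linarith [hj.2, hi.2, hl.1]

end LPCutoff
end Blocks

/-! ### Expansion of the remainder into pairs of blocks -/

section Expansion

variable {d : ℕ}

/-- The set where the essential bound holds has full measure, hence is dense, and it is closed by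
continuity. -/
theorem Continuous.enorm_le_eLpNorm_top {f : Rd d → ℂ} (hf : Continuous f) (x : Rd d) :
    ‖f x‖ₑ ≤ eLpNorm f ⊤ volume := by
  have h1 : ∀ᵐ y, ‖f y‖ₑ ≤ eLpNorm f ⊤ volume := by
    rw [eLpNorm_exponent_top]; exact ae_le_eLpNormEssSup
  have hclosed : IsClosed {y | ‖f y‖ₑ ≤ eLpNorm f ⊤ volume} :=
    isClosed_le hf.enorm continuous_const
  have := (Measure.dense_of_ae h1).closure_eq
  rw [hclosed.closure_eq] at this
  exact this.ge (Set.mem_univ x)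

theorem aestronglyMeasurable_correlation (K : 𝓢(Rd d, ℂ)) {f : Rd d → ℂ} (hf : Continuous f) :
    AEStronglyMeasurable (correlation K f) volume := by
  have h : Continuous fun q : Rd d × Rd d => K (q.2 - q.1) * f q.2 :=
    (K.continuous.comp (continuous_snd.sub continuous_fst)).mul (hf.comp continuous_snd)
  exact h.stronglyMeasurable.integral_prod_right'.aestronglyMeasurable

namespace LPCutoff

variable (χ : LPCutoff d)

theorem MemSh.tendsto_lowCut {χ : LPCutoff d} {f : 𝓢'(Rd d, ℂ)} (hf : χ.MemSh f) (x : Rd d) :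
    Tendsto (fun M : ℤ => χ.lowCut M f x) atBot (𝓝 0) := by
  rw [tendsto_zero_iff_enorm_tendsto_zero]
  exact tendsto_of_tendsto_of_tendsto_of_le_of_le tendsto_const_nhds hf (fun _ => zero_le)
    fun M => (χ.continuous_lowCut M f).enorm_le_eLpNorm_top x

theorem MemSh.eventually_norm_lowCut_le {χ : LPCutoff d} {f : 𝓢'(Rd d, ℂ)} (hf : χ.MemSh f) :
    ∀ᶠ M : ℤ in atBot, ∀ x, ‖χ.lowCut M f x‖ ≤ 1 := by
  filter_upwards [hf.eventually (ge_mem_nhds zero_lt_one)] with M hM x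
  have h1 := ((χ.continuous_lowCut M f).enorm_le_eLpNorm_top x).trans hM
  rw [← ofReal_norm] at h1
  exact ENNReal.ofReal_le_one.1 h1

theorem exists_norm_lowCut_add_one_le (N : ℤ) (f : 𝓢'(Rd d, ℂ)) :
    ∃ (k : ℕ) (B : ℝ), 0 ≤ B ∧ ∀ x, ‖χ.lowCut N f x‖ + 1 ≤ B * (1 + ‖x‖) ^ k := by
  obtain ⟨k, B, hB, h⟩ := exists_norm_schwartzMultiplier_le (χ.lowSymbol N).toSchwartz f
  refine ⟨k, B + 1, by positivity, fun x => ?_⟩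
  rw [lowCut_eq, add_mul, one_mul]
  exact add_le_add (h x) (one_le_pow₀ (by simp))

/-- Dominated convergence: for M near -∞ the cut-offs at M are at most 1 everywhere and tend to 0,
so the integrands stay below a fixed polynomial times the kernel. -/
theorem tendsto_correlation_lowCut {w z : 𝓢'(Rd d, ℂ)} (hw : χ.MemSh w) (hz : χ.MemSh z) (N : ℤ)
    (K : 𝓢(Rd d, ℂ)) (x : Rd d) :
    Tendsto (fun M : ℤ => correlation K (fun y => (χ.lowCut N w y - χ.lowCut M w y) *
      (χ.lowCut N z y - χ.lowCut M z y)) x) atBot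
      (𝓝 (correlation K (fun y => χ.lowCut N w y * χ.lowCut N z y) x)) := by
  obtain ⟨k, B, hB, h⟩ := χ.exists_norm_lowCut_add_one_le N w
  obtain ⟨k', B', hB', h'⟩ := χ.exists_norm_lowCut_add_one_le N z
  refine tendsto_integral_filter_of_dominated_convergence
    (fun y => B * B' * ((1 + ‖y‖) ^ (k + k') * ‖K (y - x)‖)) ?_ ?_
    ((K.integrable_one_add_norm_pow_mul (k + k') x).const_mul _) ?_
  · refine Eventually.of_forall fun M => Continuous.aestronglyMeasurable ?_
    exact (K.continuous.comp (continuous_sub_right x)).mul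
      (((χ.continuous_lowCut N w).sub (χ.continuous_lowCut M w)).mul
        ((χ.continuous_lowCut N z).sub (χ.continuous_lowCut M z)))
  · filter_upwards [hw.eventually_norm_lowCut_le, hz.eventually_norm_lowCut_le] with M hMw hMz
    refine Eventually.of_forall fun y => ?_
    rw [norm_mul, norm_mul]
    have e1 : ‖χ.lowCut N w y - χ.lowCut M w y‖ ≤ B * (1 + ‖y‖) ^ k :=
      (norm_sub_le _ _).trans ((add_le_add le_rfl (hMw y)).trans (h y))
    have e2 : ‖χ.lowCut N z y - χ.lowCut M z y‖ ≤ B' * (1 + ‖y‖) ^ k' :=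
      (norm_sub_le _ _).trans ((add_le_add le_rfl (hMz y)).trans (h' y))
    calc _ ≤ ‖K (y - x)‖ * ((B * (1 + ‖y‖) ^ k) * (B' * (1 + ‖y‖) ^ k')) := by gcongr
      _ = _ := by ring
  · refine Eventually.of_forall fun y => ?_
    have := ((tendsto_const_nhds (x := χ.lowCut N w y)).sub (hw.tendsto_lowCut y)).mul
      ((tendsto_const_nhds (x := χ.lowCut N z y)).sub (hz.tendsto_lowCut y))
    simpa using this.const_mul (K (y - x))

/-- The contribution of the blocks `Δ̇_i w` and `Δ̇_l z` to the remainder. -/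
def remainderTerm (w z : 𝓢'(Rd d, ℂ)) (j i l : ℤ) (x : Rd d) : ℂ :=
  (if i ≤ j - 2 then χ.block i w x * correlation (χ.blockSymbol j).kernel (χ.block l z) x else 0) -
    correlation (χ.blockSymbol j).kernel (fun y => χ.block i w y * χ.block l z y) x

theorem aestronglyMeasurable_remainderTerm (w z : 𝓢'(Rd d, ℂ)) (j i l : ℤ) :
    AEStronglyMeasurable (χ.remainderTerm w z j i l) volume := by
  unfold remainderTerm
  refine AEStronglyMeasurable.sub ?_ (aestronglyMeasurable_correlation _
    ((χ.continuous_block i w).mul (χ.continuous_block l z)))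
  split_ifs
  · exact (χ.continuous_block i w).aestronglyMeasurable.mul
      (aestronglyMeasurable_correlation _ (χ.continuous_block l z))
  · exact aestronglyMeasurable_const

/-- Telescoping over the square of indices in [M, N). The condition i ≤ j - 2 leaves the cut-off at
j - 1 minus that at M, and the range of l is wide enough to recover the whole block of z. -/
theorem sum_remainderTerm (w z : 𝓢'(Rd d, ℂ)) {j M N : ℤ} (hM : M ≤ j - 1) (hN : j + 2 ≤ N)
    (x : Rd d) :
    ∑ q ∈ Finset.Ico M N ×ˢ Finset.Ico M N, χ.remainderTerm w z j q.1 q.2 x =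
      (χ.lowCut (j - 1) w x - χ.lowCut M w x) * χ.block j z x -
        correlation (χ.blockSymbol j).kernel (fun y => (χ.lowCut N w y - χ.lowCut M w y) *
          (χ.lowCut N z y - χ.lowCut M z y)) x := by
  have hMN : M ≤ N := by omega
  set K := (χ.blockSymbol j).kernel
  have h1 : ∑ l ∈ Finset.Ico M N, correlation K (χ.block l z) x = χ.block j z x := by
    rw [← χ.correlation_lowCut_sub_lowCut hM hN z x]
    simp only [correlation, ← χ.sum_block_Ico hMN, Finset.mul_sum]
    rw [integral_finsetSum]
    intro l _
    simp only [block_eq]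
    exact integrable_sub_mul_schwartzMultiplier K _ z x
  have h2 : ∑ q ∈ Finset.Ico M N ×ˢ Finset.Ico M N,
      correlation K (fun y => χ.block q.1 w y * χ.block q.2 z y) x =
      correlation K (fun y => (χ.lowCut N w y - χ.lowCut M w y) *
          (χ.lowCut N z y - χ.lowCut M z y)) x := by
    have h : ∀ y, (χ.lowCut N w y - χ.lowCut M w y) * (χ.lowCut N z y - χ.lowCut M z y) =
        ∑ q ∈ Finset.Ico M N ×ˢ Finset.Ico M N, χ.block q.1 w y * χ.block q.2 z y := fun y => by
      rw [← χ.sum_block_Ico hMN, ← χ.sum_block_Ico hMN, Finset.sum_mul_sum, ← Finset.sum_product']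
    simp only [correlation, h, Finset.mul_sum]
    rw [integral_finsetSum]
    intro q _
    simp only [block_eq]
    exact integrable_sub_mul_schwartzMultiplier_mul K _ _ w z x
  have h3 : ∑ i ∈ Finset.Ico M N, (if i ≤ j - 2 then χ.block i w x else 0) =
      χ.lowCut (j - 1) w x - χ.lowCut M w x := by
    rw [← χ.sum_block_Ico hM, ← Finset.sum_filter]
    refine Finset.sum_congr ?_ fun _ _ => rfl
    ext i
    simp only [Finset.mem_filter, Finset.mem_Ico]
    omega
  simp only [remainderTerm, Finset.sum_sub_distrib]
  rw [h2, ← h3, ← h1, Finset.sum_mul_sum, ← Finset.sum_product']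
  simp only [ite_mul, zero_mul, K]

/-- The remainder is bounded by the sum of the contributions of all pairs of blocks. -/
theorem eLpNorm_remainder_le {w z u : 𝓢'(Rd d, ℂ)} (hw : χ.MemSh w) (hz : χ.MemSh z)
    (hu : χ.IsProduct w z u) (j : ℤ) :
    eLpNorm (χ.remainder w z u j) 2 volume ≤
      ∑' q : ℤ × ℤ, eLpNorm (χ.remainderTerm w z j q.1 q.2) 2 volume := by
  set K := (χ.blockSymbol j).kernel with hK
  set B := ∑' q : ℤ × ℤ, eLpNorm (χ.remainderTerm w z j q.1 q.2) 2 volume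
  have hbot : Tendsto (fun n : ℕ => -(n : ℤ)) atTop atBot :=
    tendsto_neg_atTop_atBot.comp tendsto_natCast_atTop_atTop
  have hmeasN : ∀ N : ℤ, AEStronglyMeasurable
      (correlation K (fun y => χ.lowCut N w y * χ.lowCut N z y)) volume := fun N =>
    aestronglyMeasurable_correlation K ((χ.continuous_lowCut N w).mul (χ.continuous_lowCut N z))
  have hmeas1 : AEStronglyMeasurable (fun x => χ.lowCut (j - 1) w x * χ.block j z x) volume :=
    ((χ.continuous_lowCut (j - 1) w).mul (χ.continuous_block j z)).aestronglyMeasurable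
  -- Two uses of Fatou: M → -∞ at fixed N here, then N → ∞. Each finite partial sum is bounded by
  -- the full sum in [0,∞].
  have hstep : ∀ N : ℤ, j + 2 ≤ N →
      eLpNorm (fun x => χ.lowCut (j - 1) w x * χ.block j z x -
        correlation K (fun y => χ.lowCut N w y * χ.lowCut N z y) x) 2 volume ≤ B := by
    intro N hN
    refine (Lp.eLpNorm_lim_le_liminf_eLpNorm (f := fun (n : ℕ) x =>
      ∑ q ∈ Finset.Ico (-(n : ℤ)) N ×ˢ Finset.Ico (-(n : ℤ)) N, χ.remainderTerm w z j q.1 q.2 x)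
      (fun n => Finset.aestronglyMeasurable_fun_sum _ fun q _ =>
        χ.aestronglyMeasurable_remainderTerm w z j q.1 q.2) _
      (Eventually.of_forall fun x => ?_)).trans ?_
    · have h1 : Tendsto (fun M : ℤ => (χ.lowCut (j - 1) w x - χ.lowCut M w x) * χ.block j z x -
          correlation K (fun y => (χ.lowCut N w y - χ.lowCut M w y) *
            (χ.lowCut N z y - χ.lowCut M z y)) x) atBot
          (𝓝 (χ.lowCut (j - 1) w x * χ.block j z x -
            correlation K (fun y => χ.lowCut N w y * χ.lowCut N z y) x)) := by
        have := ((tendsto_const_nhds (x := χ.lowCut (j - 1) w x)).sub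
          (hw.tendsto_lowCut x)).mul_const (χ.block j z x)
        rw [sub_zero] at this
        exact this.sub (χ.tendsto_correlation_lowCut hw hz N K x)
      refine (h1.comp hbot).congr' ?_
      filter_upwards [hbot.eventually (eventually_le_atBot (j - 1))] with n hn
      exact (χ.sum_remainderTerm w z hn hN x).symm
    · refine liminf_le_of_le (by isBoundedDefault) fun b hb => ?_
      obtain ⟨n, hn⟩ := hb.exists
      refine hn.trans ?_
      have h2 : (fun x => ∑ q ∈ Finset.Ico (-(n : ℤ)) N ×ˢ Finset.Ico (-(n : ℤ)) N,
          χ.remainderTerm w z j q.1 q.2 x) =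
          ∑ q ∈ Finset.Ico (-(n : ℤ)) N ×ˢ Finset.Ico (-(n : ℤ)) N,
          χ.remainderTerm w z j q.1 q.2 := by ext x; simp
      rw [h2]
      exact (eLpNorm_sum_le (fun q _ => χ.aestronglyMeasurable_remainderTerm w z j q.1 q.2)
        one_le_two).trans (ENNReal.sum_le_tsum _)
  refine (Lp.eLpNorm_lim_le_liminf_eLpNorm (f := fun (n : ℕ) x =>
    χ.lowCut (j - 1) w x * χ.block j z x -
      correlation K (fun y => χ.lowCut n w y * χ.lowCut n z y) x)
    (fun n => hmeas1.sub (hmeasN n)) _ (Eventually.of_forall fun x => ?_)).trans ?_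
  · refine tendsto_const_nhds.sub ?_
    -- The value of the block of u at x is u tested on a translate of the kernel, so convergence of
    -- the products in the sense of distributions gives pointwise convergence.
    have h3 : χ.block j u x = u (K.compSubConstCLM ℂ x) := by rw [block_eq]; rfl
    rw [h3]
    refine ((hu (K.compSubConstCLM ℂ x)).comp tendsto_natCast_atTop_atTop).congr fun n => ?_
    simp only [Function.comp_apply, correlation, SchwartzMap.compSubConstCLM_apply]
    refine integral_congr_ae (Eventually.of_forall fun y => ?_)
    exact mul_comm _ _
  · refine liminf_le_of_le (by isBoundedDefault) fun b hb => ?_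
    obtain ⟨n, hn, hn'⟩ := (hb.and
      ((tendsto_natCast_atTop_atTop (R := ℤ)).eventually (eventually_ge_atTop (j + 2)))).exists
    exact hn.trans (hstep n hn')

end LPCutoff
end Expansion

/-! ### Bernstein inequalities and bounds for one pair of blocks -/

section Bernstein

variable {d : ℕ}

theorem two_rpow_add (x y : ℝ) : (2 : ℝ≥0∞) ^ (x + y) = 2 ^ x * 2 ^ y :=
  ENNReal.rpow_add x y two_ne_zero ENNReal.ofNat_ne_top

theorem ofReal_dyadicScale (j : ℤ) :
    ENNReal.ofReal (dyadicScale j) = ENNReal.ofReal (2 * Real.pi) * 2 ^ (-(j : ℝ)) := by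
  rw [dyadicScale, mul_comm, ENNReal.ofReal_mul (by positivity)]
  congr 1
  rw [← Real.rpow_intCast, ← ENNReal.ofReal_rpow_of_pos two_pos]
  simp

theorem ofReal_inv_dyadicScale_pow_le (j : ℤ) (d : ℕ) :
    ENNReal.ofReal ((dyadicScale j ^ d)⁻¹) ≤ 2 ^ ((j : ℝ) * d) := by
  have h1 : ((dyadicScale j ^ d)⁻¹) ≤ (2 : ℝ) ^ ((j : ℝ) * d) := by
    rw [Real.rpow_mul_natCast zero_le_two, Real.rpow_intCast, ← inv_pow]
    gcongr
    · exact inv_nonneg.2 (dyadicScale_pos j).le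
    rw [dyadicScale, mul_inv, zpow_neg, inv_inv]
    refine mul_le_of_le_one_right (by positivity) (inv_le_one_of_one_le₀ ?_)
    linarith [Real.pi_gt_three]
  refine (ENNReal.ofReal_le_ofReal h1).trans (le_of_eq ?_)
  rw [← ENNReal.ofReal_rpow_of_pos two_pos]
  simp

namespace LPCutoff

variable (χ : LPCutoff d)

/-- A block is reproduced by the wider cut-off χ(·/4), which is 1 on its annulus since (8/3)/4 ≤
3/4. -/
theorem correlation_fat_block (j : ℤ) (f : 𝓢'(Rd d, ℂ)) (x : Rd d) :
    correlation ((χ.chi.dilate 4⁻¹ (by norm_num)).dilate (dyadicScale j)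
      (dyadicScale_pos j).ne').kernel (χ.block j f) x = χ.block j f x := by
  rw [block_eq]
  refine correlation_schwartzMultiplier _ _ _ (fun ξ => ?_) f x
  by_cases h0 : (χ.blockSymbol j).toSchwartz ξ = 0
  · rw [h0, mul_zero]
  have hξ := χ.norm_mem_of_blockSymbol_ne_zero j h0
  simp only [sub_self, zpow_zero, mul_one] at hξ
  have h2 : χ.toFun ((4 : ℝ)⁻¹ • dyadicScale j • ξ) = 1 := by
    refine χ.eq_one_of_norm_le ?_
    rw [norm_smul, norm_dyadicScale_smul, norm_inv, Real.norm_ofNat]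
    linarith
  have h3 : ((χ.chi.dilate 4⁻¹ (by norm_num)).dilate (dyadicScale j)
      (dyadicScale_pos j).ne').toSchwartz ξ = 1 := by
    rw [CompactSymbol.toSchwartz_apply]
    exact_mod_cast h2
  rw [h3, one_mul]

/-- The reproducing kernel has L¹ norm independent of j and sup norm O(2^{jd}); the latter enters
with the power 1/p. -/
theorem exists_enorm_block_le {p : ℝ} (hp : 1 ≤ p) :
    ∃ C : ℝ≥0∞, C ≠ ⊤ ∧ ∀ (j : ℤ) (f : 𝓢'(Rd d, ℂ)) (x : Rd d), ‖χ.block j f x‖ₑ ≤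
      C * 2 ^ ((j : ℝ) * (d / p)) * eLpNorm (χ.block j f) (ENNReal.ofReal p) volume := by
  have hp0 : 0 < p := by linarith
  have hp1 : 0 ≤ 1 - 1 / p := by
    rw [sub_nonneg, div_le_one hp0]; exact hp
  set m := χ.chi.dilate 4⁻¹ (by norm_num)
  obtain ⟨M, hM, hMle⟩ := m.exists_enorm_kernel_dilate_le
  refine ⟨(∫⁻ h, ‖m.kernel h‖ₑ) ^ (1 - 1 / p) * M ^ (1 / p), ?_, fun j f x => ?_⟩
  · refine ENNReal.mul_ne_top (ENNReal.rpow_ne_top_of_nonneg hp1 ?_)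
      (ENNReal.rpow_ne_top_of_nonneg (by positivity) hM)
    simpa using (m.lintegral_kernel_lt_top 0).ne
  · have h1 := enorm_correlation_le_eLpNorm hp _ (hMle _ (dyadicScale_pos j))
      (χ.continuous_block j f) x
    have h2 : ∫⁻ h, ‖(m.dilate (dyadicScale j) (dyadicScale_pos j).ne').kernel h‖ₑ =
        ∫⁻ h, ‖m.kernel h‖ₑ := by
      simpa using m.lintegral_kernel_dilate (dyadicScale_pos j) 0
    rw [χ.correlation_fat_block j f x, h2] at h1
    have h3 : (ENNReal.ofReal ((dyadicScale j ^ d)⁻¹) * M) ^ (1 / p) ≤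
        M ^ (1 / p) * 2 ^ ((j : ℝ) * (d / p)) := by
      rw [ENNReal.mul_rpow_of_nonneg _ _ (by positivity), mul_comm]
      gcongr
      refine (ENNReal.rpow_le_rpow (ofReal_inv_dyadicScale_pow_le j d) (by positivity)).trans
        (le_of_eq ?_)
      rw [← ENNReal.rpow_mul]
      congr 1
      ring
    refine h1.trans ?_
    rw [mul_assoc (_ ^ (1 - 1 / p)) (M ^ (1 / p))]
    gcongr

/-- Bernstein's inequality for dyadic blocks. -/
theorem exists_eLpNorm_block_le {p : ℝ} (hp : 1 ≤ p) {q : ℝ≥0∞} (hq : ENNReal.ofReal p ≤ q) :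
    ∃ C : ℝ≥0∞, C ≠ ⊤ ∧ ∀ (j : ℤ) (f : 𝓢'(Rd d, ℂ)), eLpNorm (χ.block j f) q volume ≤
      C * (2 ^ ((j : ℝ) * (d / p - d / q.toReal)) *
        eLpNorm (χ.block j f) (ENNReal.ofReal p) volume) := by
  have hp0 : 0 < p := by linarith
  obtain ⟨C, hC, h⟩ := χ.exists_enorm_block_le hp
  have hexp : 0 ≤ 1 - p / q.toReal := by
    rcases eq_or_ne q ⊤ with rfl | hqt
    · simp
    have : p ≤ q.toReal := (ENNReal.ofReal_le_iff_le_toReal hqt).1 hq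
    rw [sub_nonneg, div_le_one (by linarith)]
    exact this
  refine ⟨C ^ (1 - p / q.toReal), ENNReal.rpow_ne_top_of_nonneg hexp hC, fun j f => ?_⟩
  refine (eLpNorm_le_of_enorm_le (by simpa using hp0) hq ENNReal.ofReal_ne_top
    (χ.continuous_block j f) (h j f)).trans (le_of_eq ?_)
  rw [ENNReal.toReal_ofReal hp0.le, ENNReal.mul_rpow_of_nonneg _ _ hexp, ← ENNReal.rpow_mul,
    mul_assoc]
  congr 3
  rcases eq_or_ne q.toReal 0 with h0 | h0
  · simp [h0]
  · field_simp

/-- A symbol equal to `1` on the annulus of `φ` and vanishing near the origin. -/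
def annulusSymbol : CompactSymbol d :=
  (χ.chi.dilate 4⁻¹ (by norm_num)).sub (χ.chi.dilate 4 (by norm_num))

theorem annulusSymbol_apply (ξ : Rd d) : χ.annulusSymbol.toFun ξ =
    χ.toFun ((4 : ℝ)⁻¹ • ξ) - χ.toFun ((4 : ℝ) • ξ) := rfl

theorem contDiffAt_coord_div_norm_sq (i : Fin d) {ξ : Rd d} (hξ : ξ ≠ 0) :
    ContDiffAt ℝ ∞ (fun η : Rd d => η i / ‖η‖ ^ 2) ξ := by
  have h1 : ContDiffAt ℝ ∞ (fun η : Rd d => η i) ξ :=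
    (EuclideanSpace.proj i : Rd d →L[ℝ] ℝ).contDiff.contDiffAt
  have h2 : ContDiffAt ℝ ∞ (fun η : Rd d => ‖η‖ ^ 2) ξ :=
    ContDiff.contDiffAt (contDiff_norm_sq ℝ)
  exact h1.div h2 (pow_ne_zero 2 (norm_ne_zero_iff.2 hξ))

/-- The symbol `ξ_i / |ξ|²`, localized to an annulus. -/
def rieszSymbol (i : Fin d) : CompactSymbol d where
  toFun ξ := χ.annulusSymbol.toFun ξ * (ξ i / ‖ξ‖ ^ 2)
  smooth := by
    refine contDiff_iff_contDiffAt.2 fun ξ => ?_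
    rcases eq_or_ne ξ 0 with rfl | hξ
    -- For |η| < 3/16 both 4η and η/4 have norm less than 3/4, so the symbol is identically zero
    -- near the singularity.
    · refine ContDiffAt.congr_of_eventuallyEq (f := fun _ => (0 : ℝ)) contDiffAt_const ?_
      filter_upwards [Metric.ball_mem_nhds (0 : Rd d) (by norm_num : (0 : ℝ) < 3 / 16)] with η hη
      rw [mem_ball_zero_iff] at hη
      have h1 : χ.annulusSymbol.toFun η = 0 := by
        rw [annulusSymbol_apply, χ.eq_one_of_norm_le, χ.eq_one_of_norm_le, sub_self]
        · rw [norm_smul, Real.norm_ofNat]; linarith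
        · rw [norm_smul, norm_inv, Real.norm_ofNat]; linarith
      rw [h1, zero_mul]
    · exact χ.annulusSymbol.smooth.contDiffAt.mul (contDiffAt_coord_div_norm_sq i hξ)
  compact := χ.annulusSymbol.compact.mono fun _ hξ => left_ne_zero_of_mul hξ

theorem rieszSymbol_apply (i : Fin d) {ξ : Rd d} (h1 : 3 / 4 < ‖ξ‖) (h2 : ‖ξ‖ < 8 / 3) :
    (χ.rieszSymbol i).toFun ξ = ξ i / ‖ξ‖ ^ 2 := by
  change χ.annulusSymbol.toFun ξ * (ξ i / ‖ξ‖ ^ 2) = _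
  rw [annulusSymbol_apply, χ.eq_one_of_norm_le, χ.eq_zero_of_le_norm, sub_zero, one_mul]
  · rw [norm_smul, Real.norm_ofNat]; linarith
  · rw [norm_smul, norm_inv, Real.norm_ofNat]; linarith

/-- Symbolically 1 = Σ ξ_i · ξ_i / |ξ|². The factor -i 2^{-j} against the 2πi from ∂_i leaves
exactly the dilation factor 2^{-j} 2π. -/
theorem block_eq_sum_correlation (j : ℤ) (f : 𝓢'(Rd d, ℂ)) (x : Rd d) :
    χ.block j f x = ∑ i, (-Complex.I * (2 : ℂ) ^ (-j)) *
      correlation ((χ.rieszSymbol i).dilate (dyadicScale j) (dyadicScale_pos j).ne').kernel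
        (χ.block j (partialD i f)) x := by
  let e : Fin d → Rd d := fun i => EuclideanSpace.single i (1 : ℝ)
  let ρ : Fin d → 𝓢(Rd d, ℂ) := fun i =>
    ((χ.rieszSymbol i).dilate (dyadicScale j) (dyadicScale_pos j).ne').toSchwartz
  let b : Fin d → 𝓢(Rd d, ℂ) := fun i => (2 * Real.pi * Complex.I) •
    SchwartzMap.smulLeftCLM ℂ (fun ξ => inner ℝ ξ (e i)) (χ.blockSymbol j).toSchwartz
  have hb : ∀ i ξ, b i ξ = 2 * Real.pi * Complex.I * (inner ℝ ξ (e i) : ℝ) *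
      (χ.blockSymbol j).toSchwartz ξ := by
    intro i ξ
    have : (fun ξ => inner ℝ ξ (e i) : Rd d → ℝ).HasTemperateGrowth :=
      ((innerSL ℝ).flip (e i)).hasTemperateGrowth
    simp [b, this, mul_assoc]
  let c : Fin d → 𝓢(Rd d, ℂ) := fun i =>
    SchwartzMap.pairing (ContinuousLinearMap.mul ℂ ℂ) (ρ i) (b i)
  have hc : ∀ i ξ, c i ξ = ρ i ξ * b i ξ := fun i ξ => rfl
  have h1 : ∀ i, correlation ((χ.rieszSymbol i).dilate (dyadicScale j)
      (dyadicScale_pos j).ne').kernel (χ.block j (partialD i f)) x =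
      schwartzMultiplier (c i) f x := by
    intro i
    have h2 : χ.block j (partialD i f) = schwartzMultiplier (b i) f := by
      funext y
      rw [block_eq]
      exact schwartzMultiplier_lineDerivOp _ _ (e i) (hb i) f y
    rw [h2]
    exact correlation_schwartzMultiplier _ _ _ (hc i) f x
  simp only [h1, ← schwartzMultiplier_smul, ← schwartzMultiplier_sum]
  rw [block_eq]
  congr 1
  ext ξ
  simp only [sum_apply, smul_apply, hc, hb, smul_eq_mul]
  by_cases h0 : (χ.blockSymbol j).toSchwartz ξ = 0
  · simp [h0]
  have hξ := χ.norm_mem_of_blockSymbol_ne_zero j h0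
  simp only [sub_self, zpow_zero, mul_one] at hξ
  have hρ : ∀ i, ρ i ξ = ((dyadicScale j * ξ i / (dyadicScale j * ‖ξ‖) ^ 2 : ℝ) : ℂ) := by
    intro i
    have h3 := χ.rieszSymbol_apply i (ξ := dyadicScale j • ξ)
      (by rw [norm_dyadicScale_smul]; exact hξ.1) (by rw [norm_dyadicScale_smul]; exact hξ.2)
    rw [norm_dyadicScale_smul] at h3
    simp only [ρ, CompactSymbol.toSchwartz_apply]
    congr 1
  have hin : ∀ i, (inner ℝ ξ (e i) : ℝ) = ξ i := by
    intro i
    simp [e, EuclideanSpace.inner_single_right]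
  have hpos : 0 < dyadicScale j * ‖ξ‖ := by linarith [hξ.1]
  have hterm : ∀ i, (-Complex.I * (2 : ℂ) ^ (-j)) * (ρ i ξ * (2 * Real.pi * Complex.I *
      (inner ℝ ξ (e i) : ℝ) * (χ.blockSymbol j).toSchwartz ξ)) =
      (((dyadicScale j) ^ 2 / (dyadicScale j * ‖ξ‖) ^ 2 * (ξ i) ^ 2 : ℝ) : ℂ) *
        (χ.blockSymbol j).toSchwartz ξ := by
    intro i
    rw [hρ, hin]
    have h4 : ((dyadicScale j : ℝ) : ℂ) = (2 : ℂ) ^ (-j) * (2 * Real.pi) := by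
      simp [dyadicScale]
    have h5 : (-Complex.I * (2 : ℂ) ^ (-j)) * (2 * Real.pi * Complex.I) = (dyadicScale j : ℂ) := by
      rw [h4]
      linear_combination (-(2 : ℂ) ^ (-j) * (2 * Real.pi)) * Complex.I_mul_I
    push_cast
    rw [← h5]
    field_simp
  simp only [hterm, ← Finset.sum_mul, ← Complex.ofReal_sum, ← Finset.mul_sum]
  rw [← EuclideanSpace.real_norm_sq_eq, mul_pow, ← mul_div_right_comm, div_self (by
    have := mul_pos hpos hpos; nlinarith), Complex.ofReal_one, one_mul]

/-- The converse Bernstein inequality: the localized kernels of ξ_i / |ξ|² have L¹ norms independent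
of j, so only the factor 2^{-j} remains. -/
theorem exists_eLpNorm_block_le_partialD :
    ∃ C : ℝ≥0∞, C ≠ ⊤ ∧ ∀ (j : ℤ) (f : 𝓢'(Rd d, ℂ)), eLpNorm (χ.block j f) ⊤ volume ≤
      C * 2 ^ (-(j : ℝ)) * ∑ i, eLpNorm (χ.block j (partialD i f)) ⊤ volume := by
  refine ⟨∑ i, ∫⁻ h, ‖(χ.rieszSymbol i).kernel h‖ₑ, ?_, fun j f => ?_⟩
  · refine (ENNReal.sum_lt_top.2 fun i _ => ?_).ne
    simpa using (χ.rieszSymbol i).lintegral_kernel_lt_top 0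
  · rw [eLpNorm_exponent_top]
    refine eLpNormEssSup_le_of_ae_enorm_bound (Eventually.of_forall fun x => ?_)
    rw [block_eq_sum_correlation]
    refine (enorm_sum_le _ _).trans ?_
    rw [Finset.mul_sum]
    refine Finset.sum_le_sum fun i _ => ?_
    have h1 : ‖(-Complex.I * (2 : ℂ) ^ (-j))‖ₑ = 2 ^ (-(j : ℝ)) := by
      rw [← ofReal_norm, norm_mul, norm_neg, Complex.norm_I, one_mul, norm_zpow,
        Complex.norm_ofNat, ← Real.rpow_intCast, ← ENNReal.ofReal_rpow_of_pos two_pos]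
      simp
    have h2 : ∫⁻ h, ‖((χ.rieszSymbol i).dilate (dyadicScale j) (dyadicScale_pos j).ne').kernel h‖ₑ =
        ∫⁻ h, ‖(χ.rieszSymbol i).kernel h‖ₑ := by
      simpa using (χ.rieszSymbol i).lintegral_kernel_dilate (dyadicScale_pos j) 0
    rw [enorm_mul, h1]
    refine (mul_le_mul_right (enorm_correlation_le_eLpNorm_top _ _ _) _).trans ?_
    rw [h2, ← mul_assoc, mul_comm ((2 : ℝ≥0∞) ^ _)]
    gcongr
    exact Finset.single_le_sum (f := fun i => ∫⁻ h, ‖(χ.rieszSymbol i).kernel h‖ₑ)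
      (fun _ _ => zero_le) (Finset.mem_univ i)

/-- For i ≤ j - 2 the term is a commutator, and the first moment of the kernel of `Δ̇_j` is
proportional to 2^{-j}. The constant is the same for all Hölder pairs (q, r). -/
theorem exists_eLpNorm_remainderTerm_le_commutator :
    ∃ C : ℝ≥0∞, C ≠ ⊤ ∧ ∀ (w z : 𝓢'(Rd d, ℂ)) (j i l : ℤ), i ≤ j - 2 →
      ∀ (q r : ℝ≥0∞) [ENNReal.HolderTriple q r 2], 1 ≤ q →
      eLpNorm (χ.remainderTerm w z j i l) 2 volume ≤ C * (2 ^ (-(j : ℝ)) *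
        ((∑ n, eLpNorm (χ.block i (partialD n w)) q volume) * eLpNorm (χ.block l z) r volume)) := by
  refine ⟨ENNReal.ofReal (2 * Real.pi) * ∫⁻ h, ‖χ.phi.kernel h‖ₑ * ‖h‖ₑ, ?_, ?_⟩
  · refine ENNReal.mul_ne_top ENNReal.ofReal_ne_top ?_
    simpa using (χ.phi.lintegral_kernel_lt_top 1).ne
  · intro w z j i l hij q r _ hq
    have h1 := eLpNorm_commutator_le (χ.blockSymbol j).kernel (χ.blockSymbol i).toSchwartz
      (χ.blockSymbol l).toSchwartz w z (q := q) (r := r) hq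
    have h2 : ∫⁻ h, ‖(χ.blockSymbol j).kernel h‖ₑ * ‖h‖ₑ =
        ENNReal.ofReal (2 * Real.pi) * 2 ^ (-(j : ℝ)) * ∫⁻ h, ‖χ.phi.kernel h‖ₑ * ‖h‖ₑ := by
      rw [← ofReal_dyadicScale]
      simpa [blockSymbol] using χ.phi.lintegral_kernel_dilate (dyadicScale_pos j) 1
    rw [h2] at h1
    simp only [← block_eq] at h1
    unfold remainderTerm
    simp only [hij, if_true]
    refine h1.trans (le_of_eq ?_)
    ring

theorem exists_eLpNorm_remainderTerm_le_mul :
    ∃ C : ℝ≥0∞, C ≠ ⊤ ∧ ∀ (w z : 𝓢'(Rd d, ℂ)) (j i l : ℤ), j - 1 ≤ i →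
      ∀ (q r : ℝ≥0∞) [ENNReal.HolderTriple q r 2],
      eLpNorm (χ.remainderTerm w z j i l) 2 volume ≤
        C * (eLpNorm (χ.block i w) q volume * eLpNorm (χ.block l z) r volume) := by
  refine ⟨∫⁻ h, ‖χ.phi.kernel h‖ₑ, ?_, ?_⟩
  · simpa using (χ.phi.lintegral_kernel_lt_top 0).ne
  · intro w z j i l hij q r _
    have h2 : ∫⁻ h, ‖(χ.blockSymbol j).kernel h‖ₑ = ∫⁻ h, ‖χ.phi.kernel h‖ₑ := by
      simpa [blockSymbol] using χ.phi.lintegral_kernel_dilate (dyadicScale_pos j) 0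
    have h3 : χ.remainderTerm w z j i l =
        -correlation (χ.blockSymbol j).kernel (fun y => χ.block i w y * χ.block l z y) := by
      funext x
      simp [remainderTerm, show ¬ i ≤ j - 2 by omega]
    rw [h3, eLpNorm_neg, ← h2]
    refine (eLpNorm_correlation_two_le _
      ((χ.continuous_block i w).mul (χ.continuous_block l z))).trans ?_
    gcongr
    have h4 : eLpNorm (χ.block i w • χ.block l z) 2 volume ≤
        eLpNorm (χ.block i w) q volume * eLpNorm (χ.block l z) r volume :=
      eLpNorm_smul_le_mul_eLpNorm (χ.continuous_block l z).aestronglyMeasurable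
        (χ.continuous_block i w).aestronglyMeasurable
    exact h4

end LPCutoff
end Bernstein

/-! ### Summable dyadic weights -/

section Summation

/-- The exponentially decaying weight `2^{-s|m|}`. -/
def dyadicDecay (s : ℝ) (m : ℤ) : ℝ≥0∞ := 2 ^ (-(s * |(m : ℝ)|))

theorem tsum_dyadicDecay_lt_top {s : ℝ} (hs : 0 < s) : ∑' m : ℤ, dyadicDecay s m < ⊤ := by
  have hr : (2 : ℝ≥0∞) ^ (-s) < 1 :=
    ENNReal.rpow_lt_one_of_one_lt_of_neg (by norm_num) (by linarith)
  have hpow : ∀ n : ℕ, (2 : ℝ≥0∞) ^ (-(s * (n : ℝ))) = ((2 : ℝ≥0∞) ^ (-s)) ^ n := fun n => by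
    rw [← ENNReal.rpow_mul_natCast, neg_mul]
  have hgeom : ∑' n : ℕ, (2 : ℝ≥0∞) ^ (-(s * (n : ℝ))) < ⊤ := by
    simp only [hpow]
    rw [ENNReal.tsum_geometric, ENNReal.inv_lt_top]
    exact tsub_pos_of_lt hr
  rw [tsum_of_nat_of_neg_add_one ENNReal.summable ENNReal.summable]
  refine ENNReal.add_lt_top.2 ⟨lt_of_eq_of_lt (tsum_congr fun n => ?_) hgeom,
    lt_of_le_of_lt (ENNReal.tsum_le_tsum fun n => ?_) hgeom⟩
  · simp [dyadicDecay]
  · refine ENNReal.rpow_le_rpow_of_exponent_le (by norm_num) ?_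
    push_cast
    rw [abs_neg, abs_of_nonneg (by positivity)]
    nlinarith

theorem tsum_dyadicDecay_sub (s : ℝ) (n : ℤ) :
    ∑' j : ℤ, dyadicDecay s (j - n) = ∑' m : ℤ, dyadicDecay s m :=
  (Equiv.subRight n).tsum_eq (dyadicDecay s)

theorem ENNReal.tsum_tsum_mul {α β : Type*} (f : α → ℝ≥0∞) (g : β → ℝ≥0∞) :
    ∑' a, ∑' b, f a * g b = (∑' a, f a) * ∑' b, g b := by
  simp_rw [ENNReal.tsum_mul_left, ENNReal.tsum_mul_right]

theorem two_rpow_le_mul {a b c : ℝ} (h : a ≤ c + b) : (2 : ℝ≥0∞) ^ a ≤ 2 ^ c * 2 ^ b := by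
  rw [← two_rpow_add]
  exact ENNReal.rpow_le_rpow_of_exponent_le (by norm_num) h

theorem two_rpow_ne_top (c : ℝ) : (2 : ℝ≥0∞) ^ c ≠ ⊤ :=
  ENNReal.rpow_ne_top_of_ne_zero two_ne_zero ENNReal.ofNat_ne_top

end Summation

/-! ### The exponent p* and the four regimes of pairs -/

/-- The exponent `p* = 2p/(p-2)`, infinite for `p = 2`. -/
def pStar (p : ℝ) : ℝ≥0∞ := (ENNReal.ofReal ((p - 2) / (2 * p)))⁻¹

theorem holderTriple_pStar {p : ℝ} (hp : 2 ≤ p) :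
    ENNReal.HolderTriple (pStar p) (ENNReal.ofReal p) 2 := by
  refine ⟨?_⟩
  rw [pStar, inv_inv, ← ENNReal.ofReal_inv_of_pos (by linarith), ← ENNReal.ofReal_add
    (div_nonneg (by linarith) (by linarith)) (by positivity)]
  have : (p - 2) / (2 * p) + p⁻¹ = 2⁻¹ := by field_simp; ring
  rw [this, ENNReal.ofReal_inv_of_pos two_pos, ENNReal.ofReal_ofNat]

/-- The inequality p ≤ p* reads (p - 2)/(2p) ≤ 1/p, that is p ≤ 4. It is what lets Bernstein pass
from L^p to L^{p*}. -/
theorem ofReal_le_pStar {p : ℝ} (hp : p ∈ Set.Icc (2 : ℝ) 4) : ENNReal.ofReal p ≤ pStar p := by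
  have hp0 : 0 < p := by linarith [hp.1]
  rw [pStar, ENNReal.le_inv_iff_le_inv, ← ENNReal.ofReal_inv_of_pos hp0]
  refine ENNReal.ofReal_le_ofReal ?_
  rw [div_le_iff₀ (by positivity)]
  field_simp
  linarith [hp.2]

/-- For p = 2 both sides are 0: `toReal ⊤ = 0` and `x / 0 = 0` agree with the convention d/p* = 0.
-/
theorem div_toReal_pStar (d : ℕ) {p : ℝ} (hp : 2 ≤ p) :
    (d : ℝ) / (pStar p).toReal = dOverPStar d p := by
  rw [pStar, ENNReal.toReal_inv, ENNReal.toReal_ofReal (div_nonneg (by linarith) (by linarith)),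
    div_inv_eq_mul, dOverPStar]

namespace LPCutoff

variable {d : ℕ} (χ : LPCutoff d)

theorem remainderTerm_eq_zero {j i l : ℤ}
    (h : (i ≤ j - 2 ∧ (l ≤ j - 5 ∨ j + 5 ≤ l)) ∨ (j - 1 ≤ i ∧ i + 4 ≤ l))
    (w z : 𝓢'(Rd d, ℂ)) : χ.remainderTerm w z j i l = 0 := by
  ext x
  rw [remainderTerm, χ.correlation_block_mul_block_eq_zero h, sub_zero]
  split_ifs with hij
  · rw [χ.correlation_block_eq_zero (by omega), mul_zero]; rfl
  · rfl

/-- Bernstein's inequality `‖Δ̇_j f‖_{L^∞} ≲ 2^{jd/p} ‖Δ̇_j f‖_{L^p}`. -/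
theorem exists_eLpNorm_top_block_le_blockNorm {p : ℝ} (hp : 1 ≤ p) :
    ∃ C : ℝ≥0∞, C ≠ ⊤ ∧ ∀ (j : ℤ) (f : 𝓢'(Rd d, ℂ)),
      eLpNorm (χ.block j f) ⊤ volume ≤ C * χ.blockNorm (d / p) p f j := by
  simpa [blockNorm] using χ.exists_eLpNorm_block_le hp (q := ⊤) le_top

theorem exists_eLpNorm_pStar_block_le_blockNorm {p : ℝ} (hp : p ∈ Set.Icc (2 : ℝ) 4) :
    ∃ C : ℝ≥0∞, C ≠ ⊤ ∧ ∀ (j : ℤ) (f : 𝓢'(Rd d, ℂ)),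
      eLpNorm (χ.block j f) (pStar p) volume ≤
        C * χ.blockNorm (d / p - dOverPStar d p) p f j := by
  simpa only [blockNorm, div_toReal_pStar d hp.1] using
    χ.exists_eLpNorm_block_le (by linarith [hp.1]) (ofReal_le_pStar hp)

/-- Pairs in which the frequency of `z` is comparable to or exceeds those of `Δ̇_j` and `w`. -/
theorem exists_remainderTerm_le_grad_mul_high {p : ℝ} (hp : 1 ≤ p) {s : ℝ} (hs : 0 < s) :
    ∃ C : ℝ≥0∞, C ≠ ⊤ ∧ ∀ (w z : 𝓢'(Rd d, ℂ)) (j i l : ℤ),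
      (i ≤ j - 2 ∧ j - 4 ≤ l ∧ l ≤ j + 4) ∨ (j - 1 ≤ i ∧ i + 1 ≤ l ∧ l ≤ i + 3) →
      2 ^ ((j : ℝ) * s) * eLpNorm (χ.remainderTerm w z j i l) 2 volume ≤
        C * (dyadicDecay s (j - l) *
          ((∑ n, χ.blockNorm (d / p) p (partialD n w) i) * χ.blockNorm (s - 1) 2 z l)) := by
  obtain ⟨B, hB, hBern⟩ := χ.exists_eLpNorm_top_block_le_blockNorm hp
  obtain ⟨R, hR, hRev⟩ := χ.exists_eLpNorm_block_le_partialD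
  obtain ⟨A, hA, hcomm⟩ := χ.exists_eLpNorm_remainderTerm_le_commutator
  obtain ⟨M, hM, hmul⟩ := χ.exists_eLpNorm_remainderTerm_le_mul
  have hsum : ∀ (i : ℤ) (w : 𝓢'(Rd d, ℂ)), ∑ n, eLpNorm (χ.block i (partialD n w)) ⊤ volume ≤
      B * ∑ n, χ.blockNorm (d / p) p (partialD n w) i := fun i w => by
    rw [Finset.mul_sum]
    exact Finset.sum_le_sum fun n _ => hBern i _
  -- In the commutator case |j - l| ≤ 4: changing j(s - 1) into l(s - 1) costs 4|s - 1| in the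
  -- exponent, and inserting the decay costs 4s. In the other case j ≤ l, so the decay is exact, and
  -- l ≤ i + 3 turns 2^{-i} into 2^{-l} at the cost of 2^3.
  refine ⟨2 ^ (4 * |s - 1| + 4 * s) * A * B + 2 ^ (3 : ℝ) * M * R * B, ?_, ?_⟩
  · have := two_rpow_ne_top
    finiteness
  rintro w z j i l (⟨hij, hl1, hl2⟩ | ⟨hij, hl1, hl2⟩)
  · calc 2 ^ ((j : ℝ) * s) * eLpNorm (χ.remainderTerm w z j i l) 2 volume
        ≤ 2 ^ ((j : ℝ) * s) * (A * (2 ^ (-(j : ℝ)) *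
          ((B * ∑ n, χ.blockNorm (d / p) p (partialD n w) i) * eLpNorm (χ.block l z) 2 volume))) := by
          gcongr
          refine (hcomm w z j i l hij ⊤ 2 le_top).trans ?_
          gcongr
          exact hsum i w
      _ = 2 ^ ((j : ℝ) * s + -(j : ℝ)) * (A * B * ((∑ n, χ.blockNorm (d / p) p (partialD n w) i) *
          eLpNorm (χ.block l z) 2 volume)) := by rw [two_rpow_add]; ring
      _ ≤ 2 ^ (4 * |s - 1| + 4 * s) * 2 ^ (-(s * |((j - l : ℤ) : ℝ)|) + (l : ℝ) * (s - 1)) *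
          (A * B * ((∑ n, χ.blockNorm (d / p) p (partialD n w) i) *
          eLpNorm (χ.block l z) 2 volume)) := by
          gcongr
          refine two_rpow_le_mul ?_
          have h4 : |((j - l : ℤ) : ℝ)| ≤ 4 := by
            rw [← Int.cast_abs]
            exact_mod_cast abs_le.2 ⟨by omega, by omega⟩
          have h5 : ((j - l : ℤ) : ℝ) * (s - 1) ≤ 4 * |s - 1| := by
            refine (le_abs_self _).trans ?_
            rw [abs_mul]
            gcongr
          have h6 : s * |((j - l : ℤ) : ℝ)| ≤ s * 4 := by gcongr
          push_cast at *
          linarith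
      _ = 2 ^ (4 * |s - 1| + 4 * s) * A * B * (dyadicDecay s (j - l) *
          ((∑ n, χ.blockNorm (d / p) p (partialD n w) i) * χ.blockNorm (s - 1) 2 z l)) := by
          rw [two_rpow_add (-_), dyadicDecay, blockNorm.eq_1 χ (s - 1), ENNReal.ofReal_ofNat]
          ring
      _ ≤ _ := by gcongr; exact le_self_add
  · calc 2 ^ ((j : ℝ) * s) * eLpNorm (χ.remainderTerm w z j i l) 2 volume
        ≤ 2 ^ ((j : ℝ) * s) * (M * ((R * 2 ^ (-(i : ℝ)) *
          (B * ∑ n, χ.blockNorm (d / p) p (partialD n w) i)) *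
            eLpNorm (χ.block l z) 2 volume)) := by
          gcongr
          refine (hmul w z j i l hij ⊤ 2).trans ?_
          gcongr
          refine (hRev i w).trans ?_
          gcongr
          exact hsum i w
      _ = 2 ^ ((j : ℝ) * s + -(i : ℝ)) * (M * R * B *
          ((∑ n, χ.blockNorm (d / p) p (partialD n w) i) *
          eLpNorm (χ.block l z) 2 volume)) := by rw [two_rpow_add]; ring
      _ ≤ 2 ^ (3 : ℝ) * 2 ^ (-(s * |((j - l : ℤ) : ℝ)|) + (l : ℝ) * (s - 1)) *
          (M * R * B * ((∑ n, χ.blockNorm (d / p) p (partialD n w) i) *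
          eLpNorm (χ.block l z) 2 volume)) := by
          gcongr
          refine two_rpow_le_mul ?_
          have h4 : ((j - l : ℤ) : ℝ) ≤ 0 := by exact_mod_cast (by omega : j - l ≤ 0)
          have h5 : (l : ℝ) ≤ i + 3 := by exact_mod_cast hl2
          rw [abs_of_nonpos h4]
          push_cast
          linarith
      _ = 2 ^ (3 : ℝ) * M * R * B * (dyadicDecay s (j - l) *
          ((∑ n, χ.blockNorm (d / p) p (partialD n w) i) * χ.blockNorm (s - 1) 2 z l)) := by
          rw [two_rpow_add (-_), dyadicDecay, blockNorm.eq_1 χ (s - 1), ENNReal.ofReal_ofNat]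
          ring
      _ ≤ _ := by gcongr; exact le_add_self

/-- Pairs of low frequencies interacting through the commutator. -/
theorem exists_remainderTerm_le_gradLow_mul_low {p : ℝ} (hp : p ∈ Set.Icc (2 : ℝ) 4) {s : ℝ}
    (hs : 0 < s) (J : ℤ) (σ : ℝ) :
    ∃ C : ℝ≥0∞, C ≠ ⊤ ∧ ∀ (w z : 𝓢'(Rd d, ℂ)) (j i l : ℤ),
      J ≤ j → i ≤ j - 2 → j - 4 ≤ l → l ≤ J - 1 →
      2 ^ ((j : ℝ) * s) * eLpNorm (χ.remainderTerm w z j i l) 2 volume ≤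
        C * (dyadicDecay s (j - J) *
          ((∑ n, χ.blockNorm (d / p - dOverPStar d p) p (partialD n w) i) *
            χ.blockNorm σ p z l)) := by
  obtain ⟨B, hB, hBern⟩ := χ.exists_eLpNorm_pStar_block_le_blockNorm hp
  obtain ⟨A, hA, hcomm⟩ := χ.exists_eLpNorm_remainderTerm_le_commutator
  -- The constraints force J ≤ j ≤ J + 3 and |l - J| ≤ 4, so every weight in j and l is comparable
  -- to a constant depending on J, s and σ.
  set c : ℝ := |s - 1| * (|(J : ℝ)| + 3) + |σ| * (|(J : ℝ)| + 4) + s * 3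
  refine ⟨2 ^ c * A * B, ?_, fun w z j i l hJ hij hl1 hl2 => ?_⟩
  · have := two_rpow_ne_top
    finiteness
  have := holderTriple_pStar hp.1
  have hq : 1 ≤ pStar p := le_trans (by simpa using by linarith [hp.1]) (ofReal_le_pStar hp)
  set G := ∑ n, χ.blockNorm (d / p - dOverPStar d p) p (partialD n w) i with hG
  calc 2 ^ ((j : ℝ) * s) * eLpNorm (χ.remainderTerm w z j i l) 2 volume
      ≤ 2 ^ ((j : ℝ) * s) * (A * (2 ^ (-(j : ℝ)) *
        ((B * G) * eLpNorm (χ.block l z) (ENNReal.ofReal p) volume))) := by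
        gcongr
        refine (hcomm w z j i l hij (pStar p) (ENNReal.ofReal p) hq).trans ?_
        gcongr
        rw [hG, Finset.mul_sum]
        exact Finset.sum_le_sum fun n _ => hBern i _
    _ = 2 ^ ((j : ℝ) * s + -(j : ℝ)) *
        (A * B * (G * eLpNorm (χ.block l z) (ENNReal.ofReal p) volume)) := by
        rw [two_rpow_add]; ring
    _ ≤ 2 ^ c * 2 ^ (-(s * |((j - J : ℤ) : ℝ)|) + (l : ℝ) * σ) *
        (A * B * (G * eLpNorm (χ.block l z) (ENNReal.ofReal p) volume)) := by
        gcongr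
        refine two_rpow_le_mul ?_
        have h1 : |((j - J : ℤ) : ℝ)| ≤ 3 := by
          rw [← Int.cast_abs]
          exact_mod_cast abs_le.2 ⟨by omega, by omega⟩
        have h2 : |((l - J : ℤ) : ℝ)| ≤ 4 := by
          rw [← Int.cast_abs]
          exact_mod_cast abs_le.2 ⟨by omega, by omega⟩
        have h3 : |(j : ℝ)| ≤ |(J : ℝ)| + 3 := by
          have := abs_add_le (J : ℝ) ((j - J : ℤ) : ℝ)
          push_cast at this h1
          rw [add_sub_cancel] at this
          linarith
        have h4 : |(l : ℝ)| ≤ |(J : ℝ)| + 4 := by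
          have := abs_add_le (J : ℝ) ((l - J : ℤ) : ℝ)
          push_cast at this h2
          rw [add_sub_cancel] at this
          linarith
        have h5 : (s - 1) * j ≤ |s - 1| * (|(J : ℝ)| + 3) := by
          refine (le_abs_self _).trans ?_
          rw [abs_mul]
          gcongr
        have h6 : -(σ * l) ≤ |σ| * (|(J : ℝ)| + 4) := by
          refine (neg_le_abs _).trans ?_
          rw [abs_mul]
          gcongr
        have h7 : s * |((j - J : ℤ) : ℝ)| ≤ s * 3 := by gcongr
        simp only [c]
        linarith
    _ = 2 ^ c * A * B * (dyadicDecay s (j - J) * (G * χ.blockNorm σ p z l)) := by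
        rw [two_rpow_add (-_), dyadicDecay, blockNorm.eq_1 χ σ]
        ring

/-- Pairs in which the frequency of `w` dominates. -/
theorem exists_remainderTerm_le_high_mul {p : ℝ} (hp : 1 ≤ p) {s : ℝ} (hs : 0 < s) :
    ∃ C : ℝ≥0∞, C ≠ ⊤ ∧ ∀ k : ℝ, 0 ≤ k → ∀ (w z : 𝓢'(Rd d, ℂ)) (j i l : ℤ),
      j - 1 ≤ i → l ≤ i →
      2 ^ ((j : ℝ) * s) * eLpNorm (χ.remainderTerm w z j i l) 2 volume ≤
        C * (dyadicDecay s (j - i) * (χ.blockNorm (s + k) 2 w i * χ.blockNorm (d / p - k) p z l)) := by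
  obtain ⟨B, hB, hBern⟩ := χ.exists_eLpNorm_top_block_le_blockNorm hp
  obtain ⟨M, hM, hmul⟩ := χ.exists_eLpNorm_remainderTerm_le_mul
  -- Since j - i ≤ 1, one has (j - i) + |j - i| ≤ 2, which is the cost of replacing 2^{(j-i)s} by
  -- the decay.
  refine ⟨2 ^ (s * 2) * M * B, ?_, fun k hk w z j i l hij hl => ?_⟩
  · have := two_rpow_ne_top
    finiteness
  calc 2 ^ ((j : ℝ) * s) * eLpNorm (χ.remainderTerm w z j i l) 2 volume
      ≤ 2 ^ ((j : ℝ) * s) * (M * (eLpNorm (χ.block i w) 2 volume *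
        (B * χ.blockNorm (d / p) p z l))) := by
        gcongr
        refine (hmul w z j i l hij 2 ⊤).trans ?_
        gcongr
        exact hBern l z
    _ = 2 ^ ((j : ℝ) * s + (l : ℝ) * (d / p)) * (M * B * (eLpNorm (χ.block i w) 2 volume *
        eLpNorm (χ.block l z) (ENNReal.ofReal p) volume)) := by
        rw [two_rpow_add, blockNorm]; ring
    _ ≤ 2 ^ (s * 2) * 2 ^ (-(s * |((j - i : ℤ) : ℝ)|) + ((i : ℝ) * (s + k) + l * (d / p - k))) *
        (M * B * (eLpNorm (χ.block i w) 2 volume *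
          eLpNorm (χ.block l z) (ENNReal.ofReal p) volume)) := by
        gcongr
        refine two_rpow_le_mul ?_
        have h1 : ((j - i : ℤ) : ℝ) ≤ 1 := by exact_mod_cast (by omega : j - i ≤ 1)
        have h2 : ((j - i : ℤ) : ℝ) + |((j - i : ℤ) : ℝ)| ≤ 2 := by
          rcases abs_cases ((j - i : ℤ) : ℝ) with h | h <;> linarith
        have h3 : s * (((j - i : ℤ) : ℝ) + |((j - i : ℤ) : ℝ)|) ≤ s * 2 := by gcongr
        -- This moves k derivatives from z to w without any constant, so the bound is uniform in k.
        have h4 : (l : ℝ) * k ≤ i * k := by gcongr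
        have h5 : s * ((j - i : ℤ) : ℝ) = s * j - s * i := by push_cast; ring
        rw [mul_add, h5] at h3
        linarith
    _ = 2 ^ (s * 2) * M * B * (dyadicDecay s (j - i) *
        (χ.blockNorm (s + k) 2 w i * χ.blockNorm (d / p - k) p z l)) := by
        rw [two_rpow_add, two_rpow_add, dyadicDecay, blockNorm, blockNorm, ENNReal.ofReal_ofNat]
        ring

/-- Pairs just below the threshold. -/
theorem exists_remainderTerm_le_low_mul_low {p : ℝ} (hp : p ∈ Set.Icc (2 : ℝ) 4) (s : ℝ)
    (J : ℤ) (σ : ℝ) :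
    ∃ C : ℝ≥0∞, C ≠ ⊤ ∧ ∀ (w z : 𝓢'(Rd d, ℂ)) (l : ℤ),
      2 ^ ((J : ℝ) * s) * eLpNorm (χ.remainderTerm w z J (J - 1) l) 2 volume ≤
        C * (χ.blockNorm σ p w (J - 1) * χ.blockNorm (d / p - dOverPStar d p) p z l) := by
  obtain ⟨B, hB, hBern⟩ := χ.exists_eLpNorm_pStar_block_le_blockNorm hp
  obtain ⟨M, hM, hmul⟩ := χ.exists_eLpNorm_remainderTerm_le_mul
  -- Only one frequency of w and one value of j occur, so the weights 2^{Js} and 2^{(J-1)σ} differ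
  -- by this fixed power of 2.
  set c : ℝ := J * s - ((J - 1 : ℤ) : ℝ) * σ
  refine ⟨2 ^ c * M * B, ?_, fun w z l => ?_⟩
  · have := two_rpow_ne_top
    finiteness
  have := holderTriple_pStar hp.1
  have : ENNReal.HolderTriple (ENNReal.ofReal p) (pStar p) 2 := .symm
  calc 2 ^ ((J : ℝ) * s) * eLpNorm (χ.remainderTerm w z J (J - 1) l) 2 volume
      ≤ 2 ^ ((J : ℝ) * s) * (M * (eLpNorm (χ.block (J - 1) w) (ENNReal.ofReal p) volume *
        (B * χ.blockNorm (d / p - dOverPStar d p) p z l))) := by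
        gcongr
        refine (hmul w z J (J - 1) l le_rfl (ENNReal.ofReal p) (pStar p)).trans ?_
        gcongr
        exact hBern l z
    _ = 2 ^ (c + ((J - 1 : ℤ) : ℝ) * σ) * (M * (eLpNorm (χ.block (J - 1) w) (ENNReal.ofReal p)
        volume * (B * χ.blockNorm (d / p - dOverPStar d p) p z l))) := by
        rw [sub_add_cancel]
    _ = _ := by
        rw [two_rpow_add, blockNorm.eq_1 χ σ]
        ring

theorem besovLow_eq_tsum_indicator (J : ℤ) (σ p : ℝ) (f : 𝓢'(Rd d, ℂ)) :
    χ.besovLow J σ p f = ∑' j, (Set.Iic (J + 1)).indicator (χ.blockNorm σ p f) j :=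
  tsum_subtype _ _

theorem besovHigh_eq_tsum_indicator (J : ℤ) (σ p : ℝ) (f : 𝓢'(Rd d, ℂ)) :
    χ.besovHigh J σ p f = ∑' j, (Set.Ici J).indicator (χ.blockNorm σ p f) j :=
  tsum_subtype _ _

theorem besovGrad_eq_tsum (σ p : ℝ) (f : 𝓢'(Rd d, ℂ)) :
    χ.besovGrad σ p f = ∑' j, ∑ n, χ.blockNorm σ p (partialD n f) j :=
  (Summable.tsum_finsetSum fun _ _ => ENNReal.summable).symm

theorem besovGradLow_eq_tsum_indicator (J : ℤ) (σ p : ℝ) (f : 𝓢'(Rd d, ℂ)) :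
    χ.besovGradLow J σ p f =
      ∑' j, (Set.Iic (J + 1)).indicator (fun j => ∑ n, χ.blockNorm σ p (partialD n f) j) j := by
  simp only [besovGradLow, besovLow]
  rw [← Summable.tsum_finsetSum fun _ _ => ENNReal.summable]
  exact tsum_subtype _ (fun j => ∑ n, χ.blockNorm σ p (partialD n f) j)

/-- Each pair of blocks is controlled by the summands of one of the four products of norms. -/
theorem exists_remainderTerm_le {p : ℝ} (hp : p ∈ Set.Icc (2 : ℝ) 4) {s : ℝ} (hs : 0 < s)
    (J : ℤ) (σ₁ σ₂ : ℝ) :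
    ∃ C : ℝ≥0∞, C ≠ ⊤ ∧ ∀ k : ℝ, 0 ≤ k → ∀ (w z : 𝓢'(Rd d, ℂ)) (j i l : ℤ), J ≤ j →
      2 ^ ((j : ℝ) * s) * eLpNorm (χ.remainderTerm w z j i l) 2 volume ≤
        C * (dyadicDecay s (j - l) * ((∑ n, χ.blockNorm (d / p) p (partialD n w) i) *
            (Set.Ici J).indicator (χ.blockNorm (s - 1) 2 z) l) +
          dyadicDecay s (j - J) * ((Set.Iic (J + 1)).indicator (χ.blockNorm σ₁ p w) i *
            (Set.Iic (J + 1)).indicator (χ.blockNorm (d / p - dOverPStar d p) p z) l) +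
          dyadicDecay s (j - i) * ((Set.Ici J).indicator (χ.blockNorm (s + k) 2 w) i *
            χ.blockNorm (d / p - k) p z l) +
          dyadicDecay s (j - J) * ((Set.Iic (J + 1)).indicator (fun i =>
              ∑ n, χ.blockNorm (d / p - dOverPStar d p) p (partialD n w) i) i *
            (Set.Iic (J + 1)).indicator (χ.blockNorm σ₂ p z) l)) := by
  have hp1 : 1 ≤ p := by linarith [hp.1]
  obtain ⟨A, hA, h1⟩ := χ.exists_remainderTerm_le_grad_mul_high hp1 hs
  obtain ⟨B, hB, h2⟩ := χ.exists_remainderTerm_le_low_mul_low hp s J σ₁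
  obtain ⟨D, hD, h3⟩ := χ.exists_remainderTerm_le_high_mul hp1 hs
  obtain ⟨E, hE, h4⟩ := χ.exists_remainderTerm_le_gradLow_mul_low hp hs J σ₂
  refine ⟨A + B + D + E, by finiteness, fun k hk w z j i l hJ => ?_⟩
  by_cases hvan : (i ≤ j - 2 ∧ (l ≤ j - 5 ∨ j + 5 ≤ l)) ∨ (j - 1 ≤ i ∧ i + 4 ≤ l)
  · simp [χ.remainderTerm_eq_zero hvan]
  by_cases hA' : J ≤ l ∧
      ((i ≤ j - 2 ∧ j - 4 ≤ l ∧ l ≤ j + 4) ∨ (j - 1 ≤ i ∧ i + 1 ≤ l ∧ l ≤ i + 3))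
  · refine (h1 w z j i l hA'.2).trans ?_
    rw [← Set.indicator_of_mem (Set.mem_Ici.2 hA'.1) (χ.blockNorm (s - 1) 2 z)]
    gcongr
    · exact le_self_add.trans (le_self_add.trans le_self_add)
    · exact le_self_add.trans (le_self_add.trans le_self_add)
  by_cases hij : i ≤ j - 2
  -- Here l ≤ J - 1 and j ≤ l + 4, so j ≤ J + 3 and i ≤ j - 2 ≤ J + 1: the low-frequency sums must
  -- reach J + 1.
  · have hi : i ∈ Set.Iic (J + 1) := Set.mem_Iic.2 (by omega)
    have hl : l ∈ Set.Iic (J + 1) := Set.mem_Iic.2 (by omega)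
    refine (h4 w z j i l hJ hij (by omega) (by omega)).trans ?_
    rw [Set.indicator_of_mem hi (fun i =>
        ∑ n, χ.blockNorm (d / p - dOverPStar d p) p (partialD n w) i),
      Set.indicator_of_mem hl (χ.blockNorm σ₂ p z)]
    exact mul_le_mul' le_add_self le_add_self
  by_cases hi : J ≤ i ∧ l ≤ i
  · refine (h3 k hk w z j i l (by omega) hi.2).trans ?_
    rw [← Set.indicator_of_mem (Set.mem_Ici.2 hi.1) (χ.blockNorm (s + k) 2 w)]
    exact mul_le_mul' (le_add_self.trans le_self_add) (le_add_self.trans le_self_add)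
  -- If i ≥ J, failing l ≤ i would put the pair in the first class; hence i < J. With i ≥ j - 1 ≥ J
  -- - 1 this forces j = J and i = J - 1, and then l ≤ J - 1.
  obtain rfl : j = J := by omega
  obtain rfl : i = j - 1 := by omega
  have hi : j - 1 ∈ Set.Iic (j + 1) := Set.mem_Iic.2 (by omega)
  have hl : l ∈ Set.Iic (j + 1) := Set.mem_Iic.2 (by omega)
  refine (h2 w z l).trans ?_
  rw [Set.indicator_of_mem hi (χ.blockNorm σ₁ p w),
    Set.indicator_of_mem hl (χ.blockNorm (d / p - dOverPStar d p) p z)]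
  refine mul_le_mul' (le_add_self.trans (le_self_add.trans le_self_add))
    (le_trans (le_of_eq ?_) (le_add_self.trans (le_self_add.trans le_self_add)))
  simp [dyadicDecay]

end LPCutoff
end

/-! ### Summation over scales -/

theorem mainTheorem6 (d : ℕ) (hd : 1 ≤ d) (χ : LPCutoff d) (p : ℝ) (hp : p ∈ Set.Icc (2 : ℝ) 4)
    (s : ℝ) (hs : 0 < s) (J₁ : ℤ) (σ₁ σ₂ : ℝ) (hσ₁ : s ≤ σ₁) :
    ∃ C : ℝ≥0, ∀ k : ℝ, 0 ≤ k → ∀ w z u : 𝓢'(Rd d, ℂ),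
      χ.MemSh w → χ.MemSh z → χ.IsProduct w z u →
      ∑' j : Set.Ici J₁, (2 : ℝ≥0∞) ^ ((j : ℝ) * s) * eLpNorm (χ.remainder w z u j) 2 volume ≤
        C * (χ.besovGrad (d / p) p w * χ.besovHigh J₁ (s - 1) 2 z
          + χ.besovLow J₁ (d / p - dOverPStar d p) p z * χ.besovLow J₁ σ₁ p w
          + χ.besov (d / p - k) p z * χ.besovHigh J₁ (s + k) 2 w
          + χ.besovLow J₁ σ₂ p z * χ.besovGradLow J₁ (d / p - dOverPStar d p) p w) := by
  obtain ⟨C, hC, h⟩ := χ.exists_remainderTerm_le hp hs J₁ σ₁ σ₂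
  have hS := (tsum_dyadicDecay_lt_top hs).ne
  set S := ∑' m : ℤ, dyadicDecay s m
  refine ⟨(C * S).toNNReal, fun k hk w z u hw hz hu => ?_⟩
  rw [ENNReal.coe_toNNReal (ENNReal.mul_ne_top hC hS)]
  set a : ℤ → ℝ≥0∞ := fun i => ∑ n, χ.blockNorm (d / p) p (LPCutoff.partialD n w) i with ha
  set a' := (Set.Ici J₁).indicator (χ.blockNorm (s - 1) 2 z) with ha'
  set b := (Set.Iic (J₁ + 1)).indicator (χ.blockNorm σ₁ p w) with hb
  set b' := (Set.Iic (J₁ + 1)).indicator (χ.blockNorm (d / p - dOverPStar d p) p z) with hb'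
  set c := (Set.Ici J₁).indicator (χ.blockNorm (s + k) 2 w) with hc
  set c' := χ.blockNorm (d / p - k) p z with hc'
  set e := (Set.Iic (J₁ + 1)).indicator (fun i =>
    ∑ n, χ.blockNorm (d / p - dOverPStar d p) p (LPCutoff.partialD n w) i) with he
  set e' := (Set.Iic (J₁ + 1)).indicator (χ.blockNorm σ₂ p z) with he'
  calc ∑' j : Set.Ici J₁, (2 : ℝ≥0∞) ^ ((j : ℝ) * s) * eLpNorm (χ.remainder w z u j) 2 volume
      ≤ ∑' j : Set.Ici J₁, ∑' q : ℤ × ℤ, C * (dyadicDecay s (j - q.2) * (a q.1 * a' q.2) +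
          dyadicDecay s (j - J₁) * (b q.1 * b' q.2) + dyadicDecay s (j - q.1) * (c q.1 * c' q.2) +
          dyadicDecay s (j - J₁) * (e q.1 * e' q.2)) := by
        refine ENNReal.tsum_le_tsum fun j => ?_
        refine (mul_le_mul_right (χ.eLpNorm_remainder_le hw hz hu j) _).trans ?_
        rw [← ENNReal.tsum_mul_left]
        exact ENNReal.tsum_le_tsum fun q => h k hk w z j q.1 q.2 j.2
    -- Letting j run over all integers makes each sum of the decay factor equal to S, by translation
    -- invariance, whichever of l, i, J it is centred at.
    _ ≤ ∑' j : ℤ, ∑' q : ℤ × ℤ, C * (dyadicDecay s (j - q.2) * (a q.1 * a' q.2) +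
          dyadicDecay s (j - J₁) * (b q.1 * b' q.2) + dyadicDecay s (j - q.1) * (c q.1 * c' q.2) +
          dyadicDecay s (j - J₁) * (e q.1 * e' q.2)) :=
        ENNReal.tsum_comp_le_tsum_of_injective Subtype.val_injective (fun j : ℤ => ∑' q : ℤ × ℤ,
          C * (dyadicDecay s (j - q.2) * (a q.1 * a' q.2) +
          dyadicDecay s (j - J₁) * (b q.1 * b' q.2) + dyadicDecay s (j - q.1) * (c q.1 * c' q.2) +
          dyadicDecay s (j - J₁) * (e q.1 * e' q.2)))
    _ = ∑' q : ℤ × ℤ, C * S * (a q.1 * a' q.2 + b q.1 * b' q.2 + c q.1 * c' q.2 +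
          e q.1 * e' q.2) := by
        -- Summing over j first removes the only coupling between i and l, so the remaining double
        -- sums factor.
        rw [ENNReal.tsum_comm]
        refine tsum_congr fun q => ?_
        rw [ENNReal.tsum_mul_left, ENNReal.tsum_add, ENNReal.tsum_add, ENNReal.tsum_add]
        simp only [ENNReal.tsum_mul_right, tsum_dyadicDecay_sub]
        ring
    _ = C * S * ((∑' i, a i) * (∑' l, a' l) + (∑' i, b i) * (∑' l, b' l) +
          (∑' i, c i) * (∑' l, c' l) + (∑' i, e i) * (∑' l, e' l)) := by
        rw [ENNReal.tsum_mul_left, ENNReal.tsum_add, ENNReal.tsum_add, ENNReal.tsum_add]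
        simp only [ENNReal.tsum_prod', ENNReal.tsum_tsum_mul]
    _ = _ := by
        rw [χ.besovGrad_eq_tsum, χ.besovHigh_eq_tsum_indicator, χ.besovHigh_eq_tsum_indicator,
          χ.besovGradLow_eq_tsum_indicator, χ.besovLow_eq_tsum_indicator,
          χ.besovLow_eq_tsum_indicator, χ.besovLow_eq_tsum_indicator, LPCutoff.besov,
          mul_comm (∑' i, b i), mul_comm (∑' i, c i), mul_comm (∑' i, e i)]
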